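/- Let $a_1,a_2,a_3>0$, $\mu>0$ and $\beta,\omega\in\mathbb{R}$. Let $\mathcal{G}$ be the graph with vertices $v_{k,\ell}=(ka_1,\ell a_2,0)$ and $v_{k,\ell}^{\pm}=(ka_1,\ell a_2,\pm a_3/2)$, $(k,\ell)\in\mathbb{Z}^2$, and edges $e_{k+1/2,\ell}=(v_{k,\ell},v_{k+1,\ell})$, $e_{k,\ell+1/2}=(v_{k,\ell},v_{k,\ell+1})$, $e_{k,\ell}^{\pm}=(v_{k,\ell},v_{k,\ell}^{\pm})$; the restrictions of a function $u$ on $\mathcal{G}$ to these edges are written $u_{k+1/2,\ell}(x_1)$, $u_{k,\ell+1/2}(x_2)$, $u_{k,\ell}^{\pm}(x_3)$. Let $w^\mu_{k,\ell}=\mu$ if $k=\ell=0$ and $w^\mu_{k,\ell}=1$ otherwise, and let $L_2^\mu(\mathcal{G})$ be the Hilbert space of complex functions on $\mathcal{G}$ with $$\|u\|^2_{L_2^\mu(\mathcal{G})}=\sum_{(k,\ell)\in\mathbb{Z}^2}\Big(w^\mu_{k,\ell}\sum_{\pm}\|u_{k,\ell}^{\pm}\|^2_{L_2(e_{k,\ell}^\pm)}+\|u_{k+1/2,\ell}\|^2_{L_2(e_{k+1/2,\ell})}+\|u_{k,\ell+1/2}\|^2_{L_2(e_{k,\ell+1/2})}\Big)<\infty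 .$$ Let $H^2(\mathcal{G})$ be the space of continuous functions on $\mathcal{G}$ that are $H^2$ on every edge and whose squared $H^2$ norms over all the edges have a finite sum. Let $\mathcal{A}^\mu(\beta)$ be the unbounded operator in $L_2^\mu(\mathcal{G})$ whose domain consists of the $u\in H^2(\mathcal{G})$ such that, for all $(k,\ell)\in\mathbb{Z}^2$, $$u_{k,\ell}^+(a_3/2)=e^{-i\beta}u_{k,\ell}^-(-a_3/2),\qquad (u_{k,\ell}^+)'(a_3/2)=e^{-i\beta}(u_{k,\ell}^-)'(-a_3/2),$$ $$u'_{k+\frac12,\ell}(ka_1)-u'_{k-\frac12,\ell}(ka_1)+u'_{k,\ell+\frac12}(\ell a_2)-u'_{k,\ell-\frac12}(\ell a_2)+w^\mu_{k,\ell}\big((u_{k,\ell}^+)'(0)-(u_{k,\ell}^-)'(0)\big)=0,$$ and which is given by $\mathcal{A}^\mu(\beta)u=-u''$ on every edge. The essential spectrum of $\mathcal{A}^\mu(\beta)$ is the set of $z\in\mathbb{C}$ such that $\mathcal{A}^\mu(\beta)-z$ is not Fredholm (finite-dimensional kernel, closed range of finite codimension). Put $$\phi_\beta(\omega)=\frac{\cos(\omega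 a_3)-\cos\beta}{\sin(\omega a_3)},\qquad f(\xi,\eta,\omega)=\frac{\cos\xi-\cos(\omega a_1)}{\sin(\omega a_1)}+\frac{\cos\eta-\cos(\omega a_2)}{\sin(\omega a_2)} .$$ Assume that $\omega\notin\frac{\pi}{a_1}\mathbb{Z}\cup\frac{\pi}{a_2}\mathbb{Z}\cup\frac{\pi}{a_3}\mathbb{Z}$ and that $\omega^2$ is not in the essential spectrum of $\mathcal{A}^\mu(\beta)$. Then $\phi_\beta(\omega)-f(\xi,\eta,\omega)\neq0$ for all $(\xi,\eta)\in\mathbb{R}^2$, the function $(\xi,\eta)\mapsto\phi_\beta(\omega)/(\phi_\beta(\omega)-f(\xi,\eta,\omega))$ is integrable on $(0,2\pi)^2$ with non-zero average, so that $$F_\beta(\omega)=\Big(\frac1{4\pi^2}\int_{(0,2\pi)^2}\frac{\phi_\beta(\omega)}{\phi_\beta(\omega)-f(\xi,\eta,\omega)}\,d\xi\,d\eta\Big)^{-1}$$ is well defined, and $\omega^2$ is an eigenvalue of $\mathcal{A}^\mu(\beta)$ if and only if $\mu=1-F_\beta(\omega)$. -/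

import Mathlib

open MeasureTheory Set
open scoped ENNReal

/-! ### Eigenvalues and essential spectrum of an unbounded operator -/

section UnboundedOperators

variable {H : Type*} [NormedAddCommGroup H] [InnerProductSpace ℂ H]

/-- `z` is an eigenvalue of the unbounded operator `A`. -/
def IsEigenvalue (A : H →ₗ.[ℂ] H) (z : ℂ) : Prop :=
  ∃ u : A.domain, (u : H) ≠ 0 ∧ A u = z • (u : H)

/-- The operator `A - z`, as a linear map defined on the domain of `A`. -/
def shiftedMap (A : H →ₗ.[ℂ] H) (z : ℂ) : A.domain →ₗ[ℂ] H :=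
  A.toFun - z • A.domain.subtype

/-- `A - z` is Fredholm: its kernel has finite dimension, and its range is closed and has finite
codimension. -/
def IsFredholmAt (A : H →ₗ.[ℂ] H) (z : ℂ) : Prop :=
  FiniteDimensional ℂ (LinearMap.ker (shiftedMap A z)) ∧
  IsClosed (LinearMap.range (shiftedMap A z) : Set H) ∧
  FiniteDimensional ℂ (H ⧸ LinearMap.range (shiftedMap A z))

/-- The essential spectrum of `A`: the set of all `z` such that `A - z` is not Fredholm. -/
def essentialSpectrum (A : H →ₗ.[ℂ] H) : Set ℂ :=
  {z | ¬ IsFredholmAt A z}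

end UnboundedOperators

/-! ### The graph and its function spaces -/

/-- The edges of the graph: for `(k, l) ∈ ℤ²`, with `v k l = (k a₁, l a₂, 0)`,
* `horiz₁ k l` joins `v k l` to `v (k + 1) l`,
* `horiz₂ k l` joins `v k l` to `v k (l + 1)`,
* `up k l` joins `v k l` to `(k a₁, l a₂, a₃ / 2)`,
* `down k l` joins `v k l` to `(k a₁, l a₂, - a₃ / 2)`. -/
inductive Edge : Type
  | horiz₁ (k l : ℤ) : Edge
  | horiz₂ (k l : ℤ) : Edge
  | up (k l : ℤ) : Edge
  | down (k l : ℤ) : Edge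

instance : MeasurableSpace Edge := ⊤

instance : MeasurableSingletonClass Edge := ⟨fun _ => trivial⟩

instance : Countable Edge := by
  let g : Fin 4 × ℤ × ℤ → Edge := fun p =>
    if p.1 = 0 then .horiz₁ p.2.1 p.2.2 else if p.1 = 1 then .horiz₂ p.2.1 p.2.2
    else if p.1 = 2 then .up p.2.1 p.2.2 else .down p.2.1 p.2.2
  have hg : Function.Surjective g := by
    rintro (⟨k, l⟩ | ⟨k, l⟩ | ⟨k, l⟩ | ⟨k, l⟩)
    · exact ⟨(0, k, l), by simp [g]⟩
    · exact ⟨(1, k, l), by simp [g]⟩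
    · exact ⟨(2, k, l), by simp [g]⟩
    · exact ⟨(3, k, l), by simp [g]⟩
  exact hg.countable

namespace Edge

/-- An edge is parametrized by the coordinate `x₁`, `x₂` or `x₃` that varies along it;
`lo` is the least value of this coordinate. -/
noncomputable def lo (a₁ a₂ a₃ : ℝ) : Edge → ℝ
  | horiz₁ k _ => k * a₁
  | horiz₂ _ l => l * a₂
  | up _ _ => 0
  | down _ _ => -(a₃ / 2)

/-- The largest value of the coordinate that varies along the edge. -/
noncomputable def hi (a₁ a₂ a₃ : ℝ) : Edge → ℝ
  | horiz₁ k _ => (k + 1) * a₁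
  | horiz₂ _ l => (l + 1) * a₂
  | up _ _ => a₃ / 2
  | down _ _ => 0

end Edge

/-- The weight of a vertex: `μ` at `v 0 0` and `1` otherwise. -/
noncomputable def vertexWeight (μ : ℝ) (k l : ℤ) : ℝ :=
  if k = 0 ∧ l = 0 then μ else 1

/-- The weight of an edge: the weight of the vertex for the vertical edges, `1` for the other
edges. -/
noncomputable def edgeWeight (μ : ℝ) : Edge → ℝ
  | .up k l => vertexWeight μ k l
  | .down k l => vertexWeight μ k l
  | _ => 1

/-- The weighted length measure on the graph: a point of the graph is given by an edge and a
coordinate on it. -/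
noncomputable def graphMeasure (a₁ a₂ a₃ μ : ℝ) : Measure (Edge × ℝ) :=
  Measure.sum fun e => ENNReal.ofReal (edgeWeight μ e) •
    (volume.restrict (Icc (e.lo a₁ a₂ a₃) (e.hi a₁ a₂ a₃))).map (Prod.mk e)

/-- The Hilbert space of the functions on the graph that are square integrable for the weighted
length measure. -/
abbrev GraphL2 (a₁ a₂ a₃ μ : ℝ) : Type :=
  Lp ℂ 2 (graphMeasure a₁ a₂ a₃ μ)

/-- `u` belongs to the Sobolev space `H²(s, t)`, is its own `C¹` representative on `[s, t]`, and
has first derivative `u'` (continuous on `[s, t]`) and second derivative `u''`: both `u` and `u'`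
are absolutely continuous, with densities `u'` and `u''`, and `u''` is square integrable. -/
structure IsSobolevH2 (s t : ℝ) (u u' u'' : ℝ → ℂ) : Prop where
  memLp : MemLp u'' 2 (volume.restrict (Icc s t))
  deriv_eq : ∀ x ∈ Icc s t, u' x = u' s + ∫ y in s..x, u'' y
  eq : ∀ x ∈ Icc s t, u x = u s + ∫ y in s..x, u' y

/-- `u`, with first and second derivatives `u'` and `u''` along the edges, belongs to `H²` of the
graph: it is `H²` on every edge, continuous at every vertex `v k l`, and its `H²` norm (without
weight) is finite. -/
structure IsGraphH2 (a₁ a₂ a₃ : ℝ) (u u' u'' : Edge → ℝ → ℂ) : Prop where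
  edge : ∀ e : Edge, IsSobolevH2 (e.lo a₁ a₂ a₃) (e.hi a₁ a₂ a₃) (u e) (u' e) (u'' e)
  continuous_vertex : ∀ k l : ℤ, ∃ c : ℂ,
    u (.horiz₁ k l) (k * a₁) = c ∧ u (.horiz₁ (k - 1) l) (k * a₁) = c ∧
    u (.horiz₂ k l) (l * a₂) = c ∧ u (.horiz₂ k (l - 1)) (l * a₂) = c ∧
    u (.up k l) 0 = c ∧ u (.down k l) 0 = c
  memLp : MemLp (fun p : Edge × ℝ => u p.1 p.2) 2 (graphMeasure a₁ a₂ a₃ 1)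
  memLp_deriv : MemLp (fun p : Edge × ℝ => u' p.1 p.2) 2 (graphMeasure a₁ a₂ a₃ 1)
  memLp_deriv2 : MemLp (fun p : Edge × ℝ => u'' p.1 p.2) 2 (graphMeasure a₁ a₂ a₃ 1)

/-- `u`, with first and second derivatives `u'` and `u''`, belongs to the domain of the limit
operator: it is in `H²` of the graph, `β`-quasiperiodic, and satisfies the weighted Kirchhoff
conditions at all vertices `v k l`. -/
structure IsInDomain (a₁ a₂ a₃ β μ : ℝ) (u u' u'' : Edge → ℝ → ℂ) : Prop where
  h2 : IsGraphH2 a₁ a₂ a₃ u u' u''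
  quasiperiodic : ∀ k l : ℤ,
    u (.up k l) (a₃ / 2) = Complex.exp (-(Complex.I * β)) * u (.down k l) (-(a₃ / 2))
  quasiperiodic_deriv : ∀ k l : ℤ,
    u' (.up k l) (a₃ / 2) = Complex.exp (-(Complex.I * β)) * u' (.down k l) (-(a₃ / 2))
  kirchhoff : ∀ k l : ℤ,
    u' (.horiz₁ k l) (k * a₁) - u' (.horiz₁ (k - 1) l) (k * a₁)
      + u' (.horiz₂ k l) (l * a₂) - u' (.horiz₂ k (l - 1)) (l * a₂)
      + (vertexWeight μ k l : ℂ) * (u' (.up k l) 0 - u' (.down k l) 0) = 0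

/-! ### The operator -/

section Helpers

variable {s t : ℝ} {u u' u'' v v' v'' : ℝ → ℂ}

theorem continuousOn_of_eq_integral {f g : ℝ → ℂ} (hg : IntegrableOn g (Icc s t))
    (hf : ∀ x ∈ Icc s t, f x = f s + ∫ y in s..x, g y) : ContinuousOn f (Icc s t) := by
  by_cases hst : s ≤ t
  · refine ContinuousOn.congr (continuousOn_const.add ?_) hf
    have h1 := intervalIntegral.continuousOn_primitive_interval (μ := volume) (f := g)
      (a := s) (b := t) (by rwa [uIcc_of_le hst])
    rwa [uIcc_of_le hst] at h1
  · rw [Icc_eq_empty hst]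
    exact continuousOn_empty f

theorem ae_eq_zero_of_eq_integral {f g : ℝ → ℂ} (hg : IntegrableOn g (Icc s t))
    (hf : ∀ x ∈ Icc s t, f x = f s + ∫ y in s..x, g y)
    (h0 : ∀ x ∈ Icc s t, f x = 0) : ∀ᵐ x ∂(volume.restrict (Icc s t)), g x = 0 := by
  by_cases hst : s ≤ t
  · have hi : IntervalIntegrable g volume s t :=
      (intervalIntegrable_iff_integrableOn_Icc_of_le hst).2 hg
    have h1 : ∀ᵐ x : ℝ, x ≠ s := by simp [ae_iff, measure_singleton]
    have h2 : ∀ᵐ x : ℝ, x ≠ t := by simp [ae_iff, measure_singleton]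
    rw [ae_restrict_iff' measurableSet_Icc]
    filter_upwards [hi.ae_hasDerivAt_integral, h1, h2] with x hx hxs hxt hmem
    rw [uIcc_of_le hst] at hx
    have hd := hx hmem s (left_mem_Icc.2 hst)
    have hz : (fun x => ∫ y in s..x, g y) =ᶠ[nhds x] fun _ => 0 := by
      filter_upwards [Icc_mem_nhds (lt_of_le_of_ne hmem.1 (Ne.symm hxs))
        (lt_of_le_of_ne hmem.2 hxt)] with y hy
      have := hf y hy
      rw [h0 y hy, h0 s (left_mem_Icc.2 hst), zero_add] at this
      exact this.symm
    exact hd.unique ((hasDerivAt_const x (0 : ℂ)).congr_of_eventuallyEq hz)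
  · rw [Icc_eq_empty hst]
    simp

theorem IsSobolevH2.integrableOn₂ (h : IsSobolevH2 s t u u' u'') :
    IntegrableOn u'' (Icc s t) :=
  h.memLp.integrable (by norm_num)

theorem IsSobolevH2.continuousOn₁ (h : IsSobolevH2 s t u u' u'') : ContinuousOn u' (Icc s t) :=
  continuousOn_of_eq_integral h.integrableOn₂ h.deriv_eq

theorem IsSobolevH2.integrableOn₁ (h : IsSobolevH2 s t u u' u'') : IntegrableOn u' (Icc s t) :=
  h.continuousOn₁.integrableOn_Icc

theorem IsSobolevH2.continuousOn (h : IsSobolevH2 s t u u' u'') : ContinuousOn u (Icc s t) :=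
  continuousOn_of_eq_integral h.integrableOn₁ h.eq

theorem intervalIntegrable_of_integrableOn_Icc {g : ℝ → ℂ} (hg : IntegrableOn g (Icc s t))
    {x : ℝ} (hx : x ∈ Icc s t) : IntervalIntegrable g volume s x :=
  (intervalIntegrable_iff_integrableOn_Icc_of_le hx.1).2
    (hg.mono_set (Icc_subset_Icc le_rfl hx.2))

theorem IsSobolevH2.add (h : IsSobolevH2 s t u u' u'') (k : IsSobolevH2 s t v v' v'') :
    IsSobolevH2 s t (u + v) (u' + v') (u'' + v'') where
  memLp := h.memLp.add k.memLp
  deriv_eq x hx := by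
    simp only [Pi.add_apply]
    rw [intervalIntegral.integral_add
      (intervalIntegrable_of_integrableOn_Icc h.integrableOn₂ hx)
      (intervalIntegrable_of_integrableOn_Icc k.integrableOn₂ hx), h.deriv_eq x hx, k.deriv_eq x hx]
    ring
  eq x hx := by
    simp only [Pi.add_apply]
    rw [intervalIntegral.integral_add
      (intervalIntegrable_of_integrableOn_Icc h.integrableOn₁ hx)
      (intervalIntegrable_of_integrableOn_Icc k.integrableOn₁ hx), h.eq x hx, k.eq x hx]
    ring

theorem IsSobolevH2.smul (h : IsSobolevH2 s t u u' u'') (c : ℂ) :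
    IsSobolevH2 s t (c • u) (c • u') (c • u'') where
  memLp := h.memLp.const_smul c
  deriv_eq x hx := by
    simp only [Pi.smul_apply]
    rw [intervalIntegral.integral_smul, h.deriv_eq x hx, smul_add]
  eq x hx := by
    simp only [Pi.smul_apply]
    rw [intervalIntegral.integral_smul, h.eq x hx, smul_add]

theorem isSobolevH2_zero : IsSobolevH2 s t 0 0 0 where
  memLp := MemLp.zero
  deriv_eq x _ := by simp
  eq x _ := by simp

theorem IsSobolevH2.ae_eq_zero (h : IsSobolevH2 s t u u' u'')
    (h0 : ∀ᵐ x ∂(volume.restrict (Icc s t)), u x = 0) :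
    ∀ᵐ x ∂(volume.restrict (Icc s t)), u'' x = 0 := by
  by_cases hst : s < t
  · have hu : ∀ x ∈ Icc s t, u x = 0 := fun x hx =>
      Measure.eqOn_Icc_of_ae_eq volume hst.ne (g := fun _ => (0 : ℂ)) h0 h.continuousOn
        continuousOn_const hx
    have hu1 := ae_eq_zero_of_eq_integral h.integrableOn₁ h.eq hu
    have hu2 : ∀ x ∈ Icc s t, u' x = 0 := fun x hx =>
      Measure.eqOn_Icc_of_ae_eq volume hst.ne (g := fun _ => (0 : ℂ)) hu1 h.continuousOn₁
        continuousOn_const hx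
    exact ae_eq_zero_of_eq_integral h.integrableOn₂ h.deriv_eq hu2
  · have : volume.restrict (Icc s t) = 0 := by
      rw [Measure.restrict_eq_zero, Real.volume_Icc]
      exact ENNReal.ofReal_eq_zero.2 (by linarith)
    simp [this]

theorem edgeWeight_pos {μ : ℝ} (hμ : 0 < μ) (e : Edge) : 0 < edgeWeight μ e := by
  cases e <;> simp only [edgeWeight, vertexWeight] <;> try split_ifs
  all_goals first | exact hμ | exact one_pos

theorem ae_graphMeasure_iff {a₁ a₂ a₃ μ : ℝ} (hμ : 0 < μ) {p : Edge × ℝ → Prop} :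
    (∀ᵐ x ∂(graphMeasure a₁ a₂ a₃ μ), p x) ↔
      ∀ e : Edge, ∀ᵐ x ∂(volume.restrict (Icc (e.lo a₁ a₂ a₃) (e.hi a₁ a₂ a₃))), p (e, x) := by
  rw [graphMeasure, Measure.ae_sum_iff]
  refine forall_congr' fun e => ?_
  rw [Measure.ae_ennreal_smul_measure_iff
    (ENNReal.ofReal_pos.2 (edgeWeight_pos hμ e)).ne',
    (measurableEmbedding_prodMk_left e).ae_map_iff]

end Helpers

/-- The graph of the limit operator: all pairs `(u, -u'')` for `u` in the domain. -/
noncomputable def limitOperatorGraph (a₁ a₂ a₃ β μ : ℝ) :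
    Submodule ℂ (GraphL2 a₁ a₂ a₃ μ × GraphL2 a₁ a₂ a₃ μ) where
  carrier := {p | ∃ u u' u'' : Edge → ℝ → ℂ, IsInDomain a₁ a₂ a₃ β μ u u' u'' ∧
    (∀ᵐ x ∂(graphMeasure a₁ a₂ a₃ μ), p.1 x = u x.1 x.2) ∧
    (∀ᵐ x ∂(graphMeasure a₁ a₂ a₃ μ), p.2 x = -u'' x.1 x.2)}
  zero_mem' := by
    refine ⟨0, 0, 0, ⟨⟨fun e => isSobolevH2_zero, fun k l => ⟨0, by simp⟩, MemLp.zero, MemLp.zero,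
      MemLp.zero⟩, by simp, by simp, by simp⟩, ?_, ?_⟩
    · filter_upwards [Lp.coeFn_zero ℂ 2 (graphMeasure a₁ a₂ a₃ μ)] with x hx
      simpa using hx
    · filter_upwards [Lp.coeFn_zero ℂ 2 (graphMeasure a₁ a₂ a₃ μ)] with x hx
      simpa using hx
  add_mem' := by
    rintro ⟨p, q⟩ ⟨p', q'⟩ ⟨u, u', u'', hu, hp, hq⟩ ⟨v, v', v'', hv, hp', hq'⟩
    refine ⟨u + v, u' + v', u'' + v'', ⟨⟨fun e => (hu.h2.edge e).add (hv.h2.edge e), ?_,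
      hu.h2.memLp.add hv.h2.memLp, hu.h2.memLp_deriv.add hv.h2.memLp_deriv,
      hu.h2.memLp_deriv2.add hv.h2.memLp_deriv2⟩, ?_, ?_, ?_⟩, ?_, ?_⟩
    · intro k l
      obtain ⟨c, h1, h2, h3, h4, h5, h6⟩ := hu.h2.continuous_vertex k l
      obtain ⟨d, g1, g2, g3, g4, g5, g6⟩ := hv.h2.continuous_vertex k l
      exact ⟨c + d, by simp [*]⟩
    · intro k l
      simp only [Pi.add_apply, hu.quasiperiodic k l, hv.quasiperiodic k l]
      ring
    · intro k l
      simp only [Pi.add_apply, hu.quasiperiodic_deriv k l, hv.quasiperiodic_deriv k l]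
      ring
    · intro k l
      simp only [Pi.add_apply]
      linear_combination hu.kirchhoff k l + hv.kirchhoff k l
    · filter_upwards [hp, hp', Lp.coeFn_add p p'] with x h1 h2 h3
      simp only [Prod.mk_add_mk, h3, Pi.add_apply]
      rw [h1, h2]
    · filter_upwards [hq, hq', Lp.coeFn_add q q'] with x h1 h2 h3
      simp only [Prod.mk_add_mk, h3, Pi.add_apply]
      rw [h1, h2]
      ring
  smul_mem' := by
    rintro c ⟨p, q⟩ ⟨u, u', u'', hu, hp, hq⟩
    refine ⟨c • u, c • u', c • u'', ⟨⟨fun e => (hu.h2.edge e).smul c, ?_,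
      hu.h2.memLp.const_smul c, hu.h2.memLp_deriv.const_smul c,
      hu.h2.memLp_deriv2.const_smul c⟩, ?_, ?_, ?_⟩, ?_, ?_⟩
    · intro k l
      obtain ⟨d, h1, h2, h3, h4, h5, h6⟩ := hu.h2.continuous_vertex k l
      exact ⟨c * d, by simp [*]⟩
    · intro k l
      simp only [Pi.smul_apply, smul_eq_mul, hu.quasiperiodic k l]
      ring
    · intro k l
      simp only [Pi.smul_apply, smul_eq_mul, hu.quasiperiodic_deriv k l]
      ring
    · intro k l
      simp only [Pi.smul_apply, smul_eq_mul]
      linear_combination c * hu.kirchhoff k l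
    · filter_upwards [hp, Lp.coeFn_smul c p] with x h1 h3
      simp only [Prod.smul_mk, h3, Pi.smul_apply, smul_eq_mul]
      rw [h1]
    · filter_upwards [hq, Lp.coeFn_smul c q] with x h1 h3
      simp only [Prod.smul_mk, h3, Pi.smul_apply, smul_eq_mul]
      rw [h1]
      ring

/-- The limit operator, as an unbounded operator in the weighted `L²` space of the graph: its
domain is given by `IsInDomain`, and it maps `u` to `-u''` on every edge. -/
noncomputable def limitOperator (a₁ a₂ a₃ β μ : ℝ) :
    GraphL2 a₁ a₂ a₃ μ →ₗ.[ℂ] GraphL2 a₁ a₂ a₃ μ :=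
  (limitOperatorGraph a₁ a₂ a₃ β μ).toLinearPMap

/-- For `μ > 0`, `-u''` is determined by `u`, so that `limitOperatorGraph` is indeed the graph of
`limitOperator`. -/
theorem limitOperator_graph {a₁ a₂ a₃ β μ : ℝ} (hμ : 0 < μ) :
    (limitOperator a₁ a₂ a₃ β μ).graph = limitOperatorGraph a₁ a₂ a₃ β μ := by
  refine Submodule.toLinearPMap_graph_eq _ ?_
  rintro ⟨p, q⟩ ⟨u, u', u'', hu, hp, hq⟩ (h0 : p = 0)
  subst h0
  change q = 0
  rw [Lp.eq_zero_iff_ae_eq_zero]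
  have hu0 : ∀ᵐ x ∂(graphMeasure a₁ a₂ a₃ μ), u x.1 x.2 = 0 := by
    filter_upwards [hp, Lp.coeFn_zero ℂ 2 (graphMeasure a₁ a₂ a₃ μ)] with x h1 h2
    rw [← h1]
    exact h2
  have hu2 : ∀ᵐ x ∂(graphMeasure a₁ a₂ a₃ μ), u'' x.1 x.2 = 0 :=
    (ae_graphMeasure_iff hμ).2 fun e => (hu.h2.edge e).ae_eq_zero ((ae_graphMeasure_iff hμ).1 hu0 e)
  filter_upwards [hq, hu2] with x h1 h2
  simp only [h1, h2, neg_zero, Pi.zero_apply]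

/-! ### The functions of the criterion -/

/-- `φ_β(ω) = (cos (ω a₃) - cos β) / sin (ω a₃)`. -/
noncomputable def phi (a₃ β ω : ℝ) : ℝ :=
  (Real.cos (ω * a₃) - Real.cos β) / Real.sin (ω * a₃)

/-- `f(ξ, η, ω) = (cos ξ - cos (ω a₁)) / sin (ω a₁) + (cos η - cos (ω a₂)) / sin (ω a₂)`. -/
noncomputable def symbolF (a₁ a₂ ξ η ω : ℝ) : ℝ :=
  (Real.cos ξ - Real.cos (ω * a₁)) / Real.sin (ω * a₁)
    + (Real.cos η - Real.cos (ω * a₂)) / Real.sin (ω * a₂)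

/-- The average of `φ_β / (φ_β - f)` over the torus `(0, 2π)²`. -/
noncomputable def torusAverage (a₁ a₂ a₃ β ω : ℝ) : ℝ :=
  1 / (4 * Real.pi ^ 2) *
    ∫ p in Ioo 0 (2 * Real.pi) ×ˢ Ioo 0 (2 * Real.pi),
      phi a₃ β ω / (phi a₃ β ω - symbolF a₁ a₂ p.1 p.2 ω)

/-- `F_β(ω)`, the inverse of the torus average of `φ_β / (φ_β - f)`. -/
noncomputable def bigF (a₁ a₂ a₃ β ω : ℝ) : ℝ :=
  (torusAverage a₁ a₂ a₃ β ω)⁻¹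

/-! Since `sin (ω aᵢ) ≠ 0`, a solution of `-u'' = ω² u` on an edge is determined by its two end
values, and quasiperiodicity glues the two vertical half-edges at a vertex into one edge of length
`a₃` with end values `U` and `e^{-iβ} U`. Hence an eigenfunction is the same thing as a square
summable family of vertex values for which the Kirchhoff conditions, now difference equations on
`ℤ²`, hold (`kirchhoffSum_eq`, `isEigenvalue_iff_vertexOp`). Taking the vertex values as Fourier
coefficients of `g ∈ L²` of the torus turns these equations into `T g = m g + κ ⟨1, g⟩ 1 = 0` with
`m = -2ω(φ - f)` and `κ = -2ω(μ - 1)φ`; the rank one term is the defect at the origin.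

If `m` has no zero, then `g = -κ ⟨1, g⟩ / m`, and averaging shows that a non-zero `g` exists exactly
if `1 + κ ∫ 1/m = 0`. This reads `1 + (μ - 1) / F = 0`, that is `μ = 1 - F`
(`exists_perturbedMulOp_eq_zero_iff`, `exists_vertexOp_eq_zero_iff`).

That `m` has no zero comes from the Fredholm property. A polynomial bump on the horizontal edges
gives a bounded map `B` into `L²` of the graph such that `B y` is in the range of `A - ω²` exactly
if `y` is in the range of `T` (`sourceMap_mem_range_iff`). So `T` has closed range, and as `T` is
symmetric, its kernel embeds through `B` into the finite-dimensional cokernel of `A - ω²`. But if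
`m` vanished somewhere, functions concentrated near the zero and orthogonal to `1` and to the kernel
would make `‖T g‖ / ‖g‖` arbitrarily small, against the open mapping theorem
(`ne_zero_of_isClosed_range`).

Finally `f` vanishes at `(ω a₁, ω a₂)`, so the continuous function `φ / (φ - f)` takes the value `1`
and never `0`; it is positive, and so is its average (`torusAverage_pos`). -/

/-! ### Integration over the graph -/

/-- The edges are indexed by their type and a vertex. -/
def edgeEquiv : Fin 4 × (ℤ × ℤ) ≃ Edge where
  toFun p := match p with
    | (0, q) => .horiz₁ q.1 q.2
    | (1, q) => .horiz₂ q.1 q.2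
    | (2, q) => .up q.1 q.2
    | (3, q) => .down q.1 q.2
  invFun e := match e with
    | .horiz₁ k l => (0, k, l)
    | .horiz₂ k l => (1, k, l)
    | .up k l => (2, k, l)
    | .down k l => (3, k, l)
  left_inv := by
    rintro ⟨i, q⟩
    fin_cases i <;> rfl
  right_inv := by
    rintro (_ | _ | _ | _) <;> rfl

theorem summable_edge {f : Edge → ℝ}
    (h₁ : Summable fun p : ℤ × ℤ => f (.horiz₁ p.1 p.2))
    (h₂ : Summable fun p : ℤ × ℤ => f (.horiz₂ p.1 p.2))
    (h₃ : Summable fun p : ℤ × ℤ => f (.up p.1 p.2))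
    (h₄ : Summable fun p : ℤ × ℤ => f (.down p.1 p.2)) : Summable f := by
  have key : ∀ i : Fin 4, Summable fun p : ℤ × ℤ => f (edgeEquiv (i, p)) := by
    intro i
    fin_cases i
    · exact h₁
    · exact h₂
    · exact h₃
    · exact h₄
  rw [← edgeEquiv.summable_iff, ← (Equiv.sigmaEquivProd (Fin 4) (ℤ × ℤ)).summable_iff,
    ← summable_abs_iff, summable_sigma_of_nonneg fun _ => abs_nonneg _]
  exact ⟨fun i => (key i).abs, Summable.of_finite⟩

theorem lintegral_graphMeasure (a₁ a₂ a₃ μ : ℝ) (f : Edge × ℝ → ℝ≥0∞) :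
    ∫⁻ p, f p ∂(graphMeasure a₁ a₂ a₃ μ) = ∑' e : Edge, ENNReal.ofReal (edgeWeight μ e) *
      ∫⁻ x in Icc (e.lo a₁ a₂ a₃) (e.hi a₁ a₂ a₃), f (e, x) := by
  rw [graphMeasure, lintegral_sum_measure]
  refine tsum_congr fun e => ?_
  rw [lintegral_smul_measure, (measurableEmbedding_prodMk_left e).lintegral_map, smul_eq_mul]

theorem edgeWeight_le (μ : ℝ) (e : Edge) : edgeWeight μ e ≤ max 1 μ := by
  cases e <;> simp only [edgeWeight, vertexWeight] <;> try split_ifs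
  all_goals simp

theorem Edge.hi_sub_lo_le {a₁ a₂ a₃ : ℝ} (ha₁ : 0 < a₁) (ha₂ : 0 < a₂) (ha₃ : 0 < a₃) (e : Edge) :
    e.hi a₁ a₂ a₃ - e.lo a₁ a₂ a₃ ≤ a₁ + a₂ + a₃ := by
  cases e <;> simp only [Edge.hi, Edge.lo] <;> linarith

theorem Edge.lo_lt_hi {a₁ a₂ a₃ : ℝ} (ha₁ : 0 < a₁) (ha₂ : 0 < a₂) (ha₃ : 0 < a₃) (e : Edge) :
    e.lo a₁ a₂ a₃ < e.hi a₁ a₂ a₃ := by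
  cases e <;> simp only [Edge.hi, Edge.lo] <;> linarith

/-- There are countably many edges and all sets of edges are measurable, so measurability can be
checked edge by edge. -/
theorem measurable_uncurry_edge {F : Edge → ℝ → ℂ} (hF : ∀ e, Continuous (F e)) :
    Measurable fun p : Edge × ℝ => F p.1 p.2 :=
  measurable_from_prod_countable_right fun e => (hF e).measurable

/-- A function on the graph that is bounded on every edge by a square summable sequence is
square integrable. -/
theorem lintegral_graph_sq_le {a₁ a₂ a₃ : ℝ} (ha₁ : 0 < a₁) (ha₂ : 0 < a₂) (ha₃ : 0 < a₃) (μ : ℝ)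
    {F : Edge → ℝ → ℂ} {b : Edge → ℝ}
    (hb : ∀ e, ∀ x ∈ Icc (e.lo a₁ a₂ a₃) (e.hi a₁ a₂ a₃), ‖F e x‖ ≤ b e)
    (hs : Summable fun e => b e ^ 2) :
    ∫⁻ p, ‖F p.1 p.2‖ₑ ^ 2 ∂(graphMeasure a₁ a₂ a₃ μ) ≤
      ENNReal.ofReal (max 1 μ * (a₁ + a₂ + a₃) * ∑' e, b e ^ 2) := by
  have hL : 0 ≤ a₁ + a₂ + a₃ := by positivity
  have hM : 0 ≤ max 1 μ := le_max_of_le_left zero_le_one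
  rw [lintegral_graphMeasure, ← tsum_mul_left, ENNReal.ofReal_tsum_of_nonneg
    (fun e => by positivity) (hs.mul_left _)]
  refine ENNReal.tsum_le_tsum fun e => ?_
  have h1 : ∫⁻ x in Icc (e.lo a₁ a₂ a₃) (e.hi a₁ a₂ a₃), ‖F e x‖ₑ ^ 2 ≤
      ∫⁻ x in Icc (e.lo a₁ a₂ a₃) (e.hi a₁ a₂ a₃), ENNReal.ofReal (b e ^ 2) := by
    refine setLIntegral_mono' measurableSet_Icc fun x hx => ?_
    rw [← ofReal_norm, ← ENNReal.ofReal_pow (norm_nonneg _)]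
    exact ENNReal.ofReal_le_ofReal (pow_le_pow_left₀ (norm_nonneg _) (hb e x hx) 2)
  rw [lintegral_const, Measure.restrict_apply_univ, Real.volume_Icc,
    ← ENNReal.ofReal_mul (sq_nonneg _)] at h1
  calc _ ≤ ENNReal.ofReal (max 1 μ) * ENNReal.ofReal (b e ^ 2 * (a₁ + a₂ + a₃)) := by
        gcongr
        · exact edgeWeight_le μ e
        · exact h1.trans (ENNReal.ofReal_le_ofReal (mul_le_mul_of_nonneg_left
            (Edge.hi_sub_lo_le ha₁ ha₂ ha₃ e) (sq_nonneg _)))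
    _ = _ := by
        rw [← ENNReal.ofReal_mul hM]
        congr 1
        ring

theorem eLpNorm_two_sq {α E : Type*} [MeasurableSpace α] [NormedAddCommGroup E] (ν : Measure α)
    (f : α → E) :
    eLpNorm f 2 ν ^ 2 = ∫⁻ x, ‖f x‖ₑ ^ 2 ∂ν := by
  have := eLpNorm_nnreal_pow_eq_lintegral (f := f) (μ := ν) (p := 2) two_ne_zero
  simpa using this

theorem memLp_graph {a₁ a₂ a₃ : ℝ} (ha₁ : 0 < a₁) (ha₂ : 0 < a₂) (ha₃ : 0 < a₃) (μ : ℝ)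
    {F : Edge → ℝ → ℂ} (hF : ∀ e, Continuous (F e)) {b : Edge → ℝ}
    (hb : ∀ e, ∀ x ∈ Icc (e.lo a₁ a₂ a₃) (e.hi a₁ a₂ a₃), ‖F e x‖ ≤ b e)
    (hs : Summable fun e => b e ^ 2) :
    MemLp (fun p : Edge × ℝ => F p.1 p.2) 2 (graphMeasure a₁ a₂ a₃ μ) := by
  refine ⟨(measurable_uncurry_edge hF).aestronglyMeasurable, ?_⟩
  have h := (lintegral_graph_sq_le ha₁ ha₂ ha₃ μ hb hs).trans_lt ENNReal.ofReal_lt_top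
  rw [← eLpNorm_two_sq _ fun p : Edge × ℝ => F p.1 p.2] at h
  exact (ENNReal.pow_lt_top_iff.1 h).resolve_right two_ne_zero

/-- The squares of the `L²` norms over the horizontal edges of the first type are summable. -/
theorem tsum_horiz_lt_top {E : Type*} [NormedAddCommGroup E] {a₁ a₂ a₃ μ : ℝ} {F : Edge × ℝ → E}
    (hF : MemLp F 2 (graphMeasure a₁ a₂ a₃ μ)) :
    ∑' p : ℤ × ℤ, ∫⁻ x in Icc (p.1 * a₁) ((p.1 + 1) * a₁), ‖F (.horiz₁ p.1 p.2, x)‖ₑ ^ 2 < ∞ := by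
  have h := ENNReal.pow_lt_top_iff (n := 2) |>.2 (Or.inl hF.2)
  rw [eLpNorm_two_sq, lintegral_graphMeasure] at h
  refine lt_of_le_of_lt ?_ h
  have hi : Function.Injective fun p : ℤ × ℤ => Edge.horiz₁ p.1 p.2 := by
    rintro ⟨k, l⟩ ⟨k', l'⟩ h
    simpa using h
  refine le_trans (le_of_eq ?_) (ENNReal.tsum_comp_le_tsum_of_injective hi _)
  refine tsum_congr fun p => ?_
  simp [edgeWeight, Edge.lo, Edge.hi]

/-- Membership in `IsGraphH2` is measured without weight, whereas the operator acts in the weighted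
space; since no edge weight exceeds `max 1 μ`, square integrability carries over. -/
theorem graphMeasure_le (a₁ a₂ a₃ μ : ℝ) :
    graphMeasure a₁ a₂ a₃ μ ≤ ENNReal.ofReal (max 1 μ) • graphMeasure a₁ a₂ a₃ 1 := by
  refine Measure.le_iff.2 fun s hs => ?_
  rw [Measure.smul_apply, ← lintegral_indicator_one hs, ← lintegral_indicator_one hs,
    lintegral_graphMeasure, lintegral_graphMeasure, smul_eq_mul, ← ENNReal.tsum_mul_left]
  refine ENNReal.tsum_le_tsum fun e => ?_
  have : edgeWeight 1 e = 1 := by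
    cases e <;> simp [edgeWeight, vertexWeight]
  rw [this, ENNReal.ofReal_one, one_mul]
  exact mul_le_mul_left (ENNReal.ofReal_le_ofReal (edgeWeight_le μ e)) _

theorem MeasureTheory.MemLp.graph_of_one {a₁ a₂ a₃ : ℝ} {f : Edge × ℝ → ℂ}
    (hf : MemLp f 2 (graphMeasure a₁ a₂ a₃ 1)) (μ : ℝ) :
    MemLp f 2 (graphMeasure a₁ a₂ a₃ μ) :=
  hf.of_measure_le_smul ENNReal.ofReal_ne_top (graphMeasure_le a₁ a₂ a₃ μ)

theorem summable_add_sq {ι : Type*} {f g : ι → ℝ} (hf : Summable fun i => f i ^ 2)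
    (hg : Summable fun i => g i ^ 2) : Summable fun i => (f i + g i) ^ 2 := by
  refine Summable.of_nonneg_of_le (fun i => sq_nonneg _) (fun i => ?_)
    ((hf.mul_left 2).add (hg.mul_left 2))
  nlinarith [sq_nonneg (f i - g i)]

theorem summable_norm_mul_add_mul_sq {ι : Type*} {f g : ι → ℂ} (c d : ℂ)
    (hf : Summable fun i => ‖f i‖ ^ 2) (hg : Summable fun i => ‖g i‖ ^ 2) :
    Summable fun i => ‖c * f i + d * g i‖ ^ 2 := by
  have h := summable_add_sq (f := fun i => ‖c‖ * ‖f i‖) (g := fun i => ‖d‖ * ‖g i‖)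
    (by simpa only [mul_pow] using hf.mul_left (‖c‖ ^ 2))
    (by simpa only [mul_pow] using hg.mul_left (‖d‖ ^ 2))
  refine Summable.of_nonneg_of_le (fun i => sq_nonneg _) (fun i => ?_) h
  refine pow_le_pow_left₀ (norm_nonneg _) ((norm_add_le _ _).trans ?_) 2
  rw [norm_mul, norm_mul]

/-! ### The equation `-u'' = ω² u` on an edge -/

/-- On an interval, an `H²` solution of `u'' = -ω² u` is a trigonometric function. -/
theorem IsSobolevH2.eq_trig {s t ω : ℝ} {u u' u'' : ℝ → ℂ} (h : IsSobolevH2 s t u u' u'')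
    (hst : s ≤ t)
    (ode : ∀ᵐ x ∂(volume.restrict (Icc s t)), u'' x = -(ω : ℂ) ^ 2 * u x) :
    ∀ x ∈ Icc s t,
      ω * u x = ω * u s * Real.cos (ω * (x - s)) + u' s * Real.sin (ω * (x - s)) ∧
      u' x = -ω * u s * Real.sin (ω * (x - s)) + u' s * Real.cos (ω * (x - s)) := by
  -- The data are controlled on `[s, t]` only, and `u''` only almost everywhere. Extending `u`
  -- continuously to `ℝ` and integrating `-ω² v` twice gives functions `V`, `U` that are
  -- differentiable everywhere and agree with `u'`, `u` on `[s, t]`.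
  set v : ℝ → ℂ := IccExtend hst ((Icc s t).domRestrict u) with hv
  have hvc : Continuous v := h.continuousOn.domRestrict.Icc_extend'
  have hvu : ∀ x ∈ Icc s t, v x = u x := fun x hx => by
    rw [hv, IccExtend_of_mem hst _ hx]; rfl
  set V : ℝ → ℂ := fun x => u' s + ∫ y in s..x, -(ω : ℂ) ^ 2 * v y with hV
  have hVd : ∀ x, HasDerivAt V (-(ω : ℂ) ^ 2 * v x) x := fun x =>
    ((continuous_const.mul hvc).integral_hasStrictDerivAt s x).hasDerivAt.const_add _
  have hVc : Continuous V := continuous_iff_continuousAt.2 fun x => (hVd x).continuousAt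
  have hVu : ∀ x ∈ Icc s t, V x = u' x := fun x hx => by
    rw [h.deriv_eq x hx, hV]
    dsimp only
    congr 1
    rw [intervalIntegral.integral_of_le hx.1, intervalIntegral.integral_of_le hx.1]
    have hsub : Ioc s x ⊆ Icc s t := fun y hy => ⟨hy.1.le, hy.2.trans hx.2⟩
    refine setIntegral_congr_ae measurableSet_Ioc ?_
    rw [ae_restrict_iff' measurableSet_Icc] at ode
    filter_upwards [ode] with y hy hys
    rw [hy (hsub hys), hvu y (hsub hys)]
  set U : ℝ → ℂ := fun x => u s + ∫ y in s..x, V y with hU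
  have hUd : ∀ x, HasDerivAt U (V x) x := fun x =>
    (hVc.integral_hasStrictDerivAt s x).hasDerivAt.const_add _
  have hUu : ∀ x ∈ Icc s t, U x = u x := fun x hx => by
    rw [h.eq x hx, hU]
    dsimp only
    congr 1
    refine intervalIntegral.integral_congr fun y hy => ?_
    rw [uIcc_of_le hx.1] at hy
    exact hVu y ⟨hy.1, hy.2.trans hx.2⟩
  have hUc : Continuous U := continuous_iff_continuousAt.2 fun x => (hUd x).continuousAt
  have hsin : ∀ x, HasDerivAt (fun x : ℝ => ((Real.sin (ω * (x - s)) : ℝ) : ℂ))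
      (Real.cos (ω * (x - s)) * ω) x := fun x => by
    have := ((Real.hasDerivAt_sin (ω * (x - s))).comp x
      (((hasDerivAt_id x).sub_const s).const_mul ω)).ofReal_comp
    simpa using this
  have hcos : ∀ x, HasDerivAt (fun x : ℝ => ((Real.cos (ω * (x - s)) : ℝ) : ℂ))
      (-Real.sin (ω * (x - s)) * ω) x := fun x => by
    have := ((Real.hasDerivAt_cos (ω * (x - s))).comp x
      (((hasDerivAt_id x).sub_const s).const_mul ω)).ofReal_comp
    simpa using this
  -- The Wronskians of `U` with `sin (ω (x - s))` and with `cos (ω (x - s))` are constant. The two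
  -- identities form a linear system for `ω u x` and `u' x` of determinant `sin² + cos² = 1` up to
  -- sign.
  have hW₁ := constant_of_has_deriv_right_zero (a := s) (b := t)
    (f := fun x => V x * (Real.sin (ω * (x - s)) : ℝ) - ω * U x * (Real.cos (ω * (x - s)) : ℝ))
    (by fun_prop) fun x hx => by
      have := ((hVd x).mul (hsin x)).sub (((hUd x).const_mul (ω : ℂ)).mul (hcos x))
      refine (this.congr_deriv ?_).hasDerivWithinAt
      rw [hvu x ⟨hx.1, hx.2.le⟩, hUu x ⟨hx.1, hx.2.le⟩]
      ring
  have hW₂ := constant_of_has_deriv_right_zero (a := s) (b := t)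
    (f := fun x => V x * (Real.cos (ω * (x - s)) : ℝ) + ω * U x * (Real.sin (ω * (x - s)) : ℝ))
    (by fun_prop) fun x hx => by
      have := ((hVd x).mul (hcos x)).add (((hUd x).const_mul (ω : ℂ)).mul (hsin x))
      refine (this.congr_deriv ?_).hasDerivWithinAt
      rw [hvu x ⟨hx.1, hx.2.le⟩, hUu x ⟨hx.1, hx.2.le⟩]
      ring
  intro x hx
  have hs : s ∈ Icc s t := left_mem_Icc.2 hst
  have h₁ := hW₁ x hx
  have h₂ := hW₂ x hx
  simp only [hVu x hx, hUu x hx, hVu s hs, hUu s hs, sub_self, mul_zero, Real.sin_zero,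
    Real.cos_zero, Complex.ofReal_zero, Complex.ofReal_one, mul_one, zero_sub, add_zero] at h₁ h₂
  have hsc : ((Real.sin (ω * (x - s)) : ℝ) : ℂ) ^ 2 + ((Real.cos (ω * (x - s)) : ℝ) : ℂ) ^ 2 = 1 := by
    exact_mod_cast Real.sin_sq_add_cos_sq (ω * (x - s))
  constructor
  · linear_combination (Real.sin (ω * (x - s)) : ℂ) * h₂ - (Real.cos (ω * (x - s)) : ℂ) * h₁ -
      ω * u x * hsc
  · linear_combination (Real.sin (ω * (x - s)) : ℂ) * h₁ + (Real.cos (ω * (x - s)) : ℂ) * h₂ -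
      u' x * hsc

theorem isSobolevH2_of_hasDerivAt {s t : ℝ} {u u' u'' : ℝ → ℂ} (h₁ : ∀ x, HasDerivAt u (u' x) x)
    (h₂ : ∀ x, HasDerivAt u' (u'' x) x) (hc : Continuous u'') : IsSobolevH2 s t u u' u'' where
  memLp := by
    obtain ⟨C, hC⟩ := isCompact_Icc.exists_bound_of_continuousOn (s := Icc s t) hc.continuousOn
    exact MemLp.of_bound hc.aestronglyMeasurable C
      ((ae_restrict_iff' measurableSet_Icc).2 (.of_forall hC))
  deriv_eq x _ := by
    rw [intervalIntegral.integral_eq_sub_of_hasDerivAt (fun y _ => h₂ y)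
      (hc.intervalIntegrable _ _)]
    ring
  eq x _ := by
    have : Continuous u' := continuous_iff_continuousAt.2 fun x => (h₂ x).continuousAt
    rw [intervalIntegral.integral_eq_sub_of_hasDerivAt (fun y _ => h₁ y)
      (this.intervalIntegrable _ _)]
    ring

/-- The solution of `u'' = -ω² u` with `u s = α` and `u' s = ω γ`. -/
noncomputable def trigSolution (ω s : ℝ) (α γ : ℂ) (x : ℝ) : ℂ :=
  α * Real.cos (ω * (x - s)) + γ * Real.sin (ω * (x - s))

theorem continuous_trigSolution (ω s : ℝ) (α γ : ℂ) : Continuous (trigSolution ω s α γ) := by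
  unfold trigSolution
  fun_prop

/-- Up to the factor `ω`, differentiation rotates the coefficients `(α, γ)` to `(γ, -α)`, so
continuity and bounds for derivatives are those of another `trigSolution`. -/
theorem hasDerivAt_trigSolution (ω s : ℝ) (α γ : ℂ) (x : ℝ) :
    HasDerivAt (trigSolution ω s α γ) (ω * trigSolution ω s γ (-α) x) x := by
  have hsin : HasDerivAt (fun x : ℝ => ((Real.sin (ω * (x - s)) : ℝ) : ℂ))
      (Real.cos (ω * (x - s)) * ω) x := by
    have := ((Real.hasDerivAt_sin (ω * (x - s))).comp x
      (((hasDerivAt_id x).sub_const s).const_mul ω)).ofReal_comp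
    simpa using this
  have hcos : HasDerivAt (fun x : ℝ => ((Real.cos (ω * (x - s)) : ℝ) : ℂ))
      (-Real.sin (ω * (x - s)) * ω) x := by
    have := ((Real.hasDerivAt_cos (ω * (x - s))).comp x
      (((hasDerivAt_id x).sub_const s).const_mul ω)).ofReal_comp
    simpa using this
  refine ((hcos.const_mul α).add (hsin.const_mul γ)).congr_deriv ?_
  unfold trigSolution
  ring

theorem norm_trigSolution_le (ω s : ℝ) (α γ : ℂ) (x : ℝ) :
    ‖trigSolution ω s α γ x‖ ≤ ‖α‖ + ‖γ‖ := by
  unfold trigSolution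
  refine (norm_add_le _ _).trans (add_le_add ?_ ?_) <;> rw [norm_mul, Complex.norm_real]
  · exact mul_le_of_le_one_right (norm_nonneg _) (Real.abs_cos_le_one _)
  · exact mul_le_of_le_one_right (norm_nonneg _) (Real.abs_sin_le_one _)

theorem isSobolevH2_trigSolution (ω s t s₀ : ℝ) (α γ : ℂ) :
    IsSobolevH2 s t (trigSolution ω s₀ α γ) (fun x => ω * trigSolution ω s₀ γ (-α) x)
      (fun x => -ω ^ 2 * trigSolution ω s₀ α γ x) := by
  refine isSobolevH2_of_hasDerivAt (hasDerivAt_trigSolution ω s₀ α γ) (fun x => ?_)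
    (continuous_const.mul (continuous_trigSolution ω s₀ α γ))
  refine ((hasDerivAt_trigSolution ω s₀ γ (-α) x).const_mul (ω : ℂ)).congr_deriv ?_
  unfold trigSolution
  ring

/-! ### Square integrable functions on the torus and their Fourier coefficients -/

section Torus

attribute [local instance] instMeasureSpaceUnitAddCircle

local instance : Measure.IsAddHaarMeasure (volume : Measure UnitAddCircle) :=
  inferInstanceAs (Measure.IsAddHaarMeasure AddCircle.haarAddCircle)

local instance : IsProbabilityMeasure (volume : Measure UnitAddCircle) :=
  inferInstanceAs (IsProbabilityMeasure AddCircle.haarAddCircle)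

/-- The two-dimensional torus `(ℝ / ℤ)²`. -/
abbrev Torus : Type := UnitAddTorus (Fin 2)

/-- The normalized Haar measure of the torus. -/
noncomputable abbrev torusMeasure : Measure Torus := volume

theorem isProbabilityMeasure_torusMeasure : IsProbabilityMeasure torusMeasure := inferInstance

theorem isOpenPosMeasure_torusMeasure : torusMeasure.IsOpenPosMeasure := inferInstance

attribute [local instance] isProbabilityMeasure_torusMeasure isOpenPosMeasure_torusMeasure

/-- The space of square integrable functions on the torus. -/
abbrev TorusL2 : Type := Lp ℂ 2 torusMeasure

/-- The Fourier coefficients of a square integrable function on the torus. -/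
noncomputable def coeff (g : TorusL2) (k l : ℤ) : ℂ := UnitAddTorus.mFourierCoeff g ![k, l]

/-- The coefficients are coordinates in a Hilbert basis; linearity, uniqueness and existence for
given square summable coefficients follow from the isometry with `ℓ²`. -/
theorem coeff_eq_repr (g : TorusL2) (k l : ℤ) :
    coeff g k l = UnitAddTorus.mFourierBasis.repr g ![k, l] :=
  (UnitAddTorus.mFourierBasis_repr g _).symm

theorem coeff_add (g h : TorusL2) (k l : ℤ) : coeff (g + h) k l = coeff g k l + coeff h k l := by
  simp only [coeff_eq_repr, map_add, lp.coeFn_add, Pi.add_apply]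

theorem coeff_smul (c : ℂ) (g : TorusL2) (k l : ℤ) : coeff (c • g) k l = c * coeff g k l := by
  simp only [coeff_eq_repr, map_smul, lp.coeFn_smul, Pi.smul_apply, smul_eq_mul]

theorem coeff_zero (k l : ℤ) : coeff 0 k l = 0 := by
  simp only [coeff_eq_repr, map_zero, lp.coeFn_zero, Pi.zero_apply]

theorem coeff_ext {g h : TorusL2} (hgh : ∀ k l, coeff g k l = coeff h k l) : g = h := by
  apply UnitAddTorus.mFourierBasis.repr.injective
  ext i
  have := hgh (i 0) (i 1)
  rw [coeff_eq_repr, coeff_eq_repr] at this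
  rwa [show ![i 0, i 1] = i from List.ofFn_inj.mp rfl] at this

theorem hasSum_sq_coeff (g : TorusL2) :
    HasSum (fun p : ℤ × ℤ => ‖coeff g p.1 p.2‖ ^ 2) (‖g‖ ^ 2) := by
  have h := UnitAddTorus.hasSum_sq_mFourierCoeff g
  have h2 : ∫ t, ‖g t‖ ^ 2 = ‖g‖ ^ 2 := by
    rw [← @inner_self_eq_norm_sq ℂ, L2.inner_def, ← integral_re (L2.integrable_inner g g)]
    simp only [inner_self_eq_norm_sq]
  rw [h2, ← (finTwoArrowEquiv ℤ).symm.hasSum_iff] at h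
  exact h

theorem summable_sq_coeff (g : TorusL2) : Summable fun p : ℤ × ℤ => ‖coeff g p.1 p.2‖ ^ 2 :=
  (hasSum_sq_coeff g).summable

theorem summable_sq_coeff_shift (g : TorusL2) (i j : ℤ) :
    Summable fun p : ℤ × ℤ => ‖coeff g (p.1 + i) (p.2 + j)‖ ^ 2 :=
  (Equiv.addRight ((i, j) : ℤ × ℤ)).summable_iff.2 (summable_sq_coeff g)

/-- Riesz–Fischer: this turns the vertex values of a solution into a function on the torus. -/
theorem exists_coeff_eq {a : ℤ × ℤ → ℂ} (ha : Summable fun p => ‖a p‖ ^ 2) :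
    ∃ g : TorusL2, ∀ k l, coeff g k l = a (k, l) := by
  have hm : Memℓp (fun i : Fin 2 → ℤ => a (finTwoArrowEquiv ℤ i)) 2 := by
    rw [memℓp_gen_iff (by norm_num)]
    have := (finTwoArrowEquiv ℤ).summable_iff.2 ha
    simpa [Function.comp_def] using this
  refine ⟨UnitAddTorus.mFourierBasis.repr.symm ⟨_, hm⟩, fun k l => ?_⟩
  rw [coeff_eq_repr, LinearIsometryEquiv.apply_symm_apply]
  rfl

/-! ### Multiplication operators -/

/-- Multiplication by a continuous function, as an operator in `L²` of the torus. -/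
noncomputable def mulOp : C(Torus, ℂ) →L[ℂ] TorusL2 →L[ℂ] TorusL2 :=
  ((ContinuousLinearMap.mul ℂ ℂ).holderL torusMeasure ∞ 2 2).comp
    (ContinuousMap.toLp ∞ torusMeasure ℂ)

theorem coeFn_mulOp (m : C(Torus, ℂ)) (g : TorusL2) :
    mulOp m g =ᵐ[torusMeasure] fun x => m x * g x := by
  have h := (ContinuousLinearMap.mul ℂ ℂ).coeFn_holder (r := 2)
    (ContinuousMap.toLp ∞ torusMeasure ℂ m) g
  filter_upwards [h, ContinuousMap.coeFn_toLp (p := ∞) (𝕜 := ℂ) torusMeasure m] with x h1 hx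
  refine Eq.trans (by exact h1) ?_
  rw [ContinuousLinearMap.mul_apply', hx]

/-- A character shifts the frequencies, which is why difference operators on `ℤ²` become
multiplications. -/
theorem coeff_mulOp_mFourier (g : TorusL2) (i j k l : ℤ) :
    coeff (mulOp (UnitAddTorus.mFourier ![i, j]) g) k l = coeff g (k - i) (l - j) := by
  refine integral_congr_ae ?_
  filter_upwards [coeFn_mulOp (UnitAddTorus.mFourier ![i, j]) g] with x hx
  rw [hx, smul_eq_mul, smul_eq_mul, ← mul_assoc, ← UnitAddTorus.mFourier_add]
  congr 3
  ext r
  fin_cases r <;> simp <;> ring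

/-- The constant function `1` on the torus. -/
noncomputable def torusOne : TorusL2 := UnitAddTorus.mFourierLp 2 0

theorem coeFn_torusOne : torusOne =ᵐ[torusMeasure] fun _ => 1 := by
  filter_upwards [UnitAddTorus.coeFn_mFourierLp (d := Fin 2) 2 0] with x hx
  rw [torusOne, hx, UnitAddTorus.mFourier_zero]
  rfl

theorem coeff_torusOne (k l : ℤ) : coeff torusOne k l = if k = 0 ∧ l = 0 then 1 else 0 := by
  rw [coeff_eq_repr, torusOne, ← UnitAddTorus.coe_mFourierBasis, HilbertBasis.repr_self,
    lp.single_apply]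
  simp [Pi.single_apply, funext_iff]

theorem coeff_zero_zero_eq_inner (g : TorusL2) : coeff g 0 0 = inner ℂ torusOne g := by
  rw [coeff_eq_repr, HilbertBasis.repr_apply_apply, UnitAddTorus.coe_mFourierBasis, torusOne]
  congr 2
  ext r
  fin_cases r <;> rfl

theorem coeff_zero_zero_eq_integral (g : TorusL2) : coeff g 0 0 = ∫ x, g x ∂torusMeasure := by
  rw [coeff, UnitAddTorus.mFourierCoeff]
  have : -![(0 : ℤ), 0] = 0 := by
    ext r
    fin_cases r <;> rfl
  simp [this, UnitAddTorus.mFourier_zero]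

/-- The sum of a multiplication operator and of the rank one operator `κ ⟨1, ·⟩ 1`. -/
noncomputable def perturbedMulOp (m : C(Torus, ℂ)) (κ : ℂ) : TorusL2 →L[ℂ] TorusL2 :=
  mulOp m + κ • (innerSL ℂ torusOne).smulRight torusOne

theorem perturbedMulOp_apply (m : C(Torus, ℂ)) (κ : ℂ) (g : TorusL2) :
    perturbedMulOp m κ g = mulOp m g + (κ * coeff g 0 0) • torusOne := by
  simp [perturbedMulOp, coeff_zero_zero_eq_inner, smul_smul]

theorem mulOp_eq_zero {m : C(Torus, ℂ)} (hm : ∀ x, m x ≠ 0) {g : TorusL2} (hg : mulOp m g = 0) :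
    g = 0 := by
  rw [Lp.eq_zero_iff_ae_eq_zero]
  filter_upwards [coeFn_mulOp m g, (Lp.eq_zero_iff_ae_eq_zero).1 hg] with x h1 h2
  rw [h1] at h2
  exact (mul_eq_zero.1 h2).resolve_left (hm x)

/-- If `m` has no zero, then `m + κ ⟨1, ·⟩ 1` has a non-trivial kernel exactly if
`1 + κ ∫ 1 / m = 0`. -/
theorem exists_perturbedMulOp_eq_zero_iff {m : C(Torus, ℂ)} (hm : ∀ x, m x ≠ 0) (κ : ℂ) :
    (∃ g, g ≠ 0 ∧ perturbedMulOp m κ g = 0) ↔ 1 + κ * ∫ x, (m x)⁻¹ ∂torusMeasure = 0 := by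
  -- Without zeros of `m`, the function `1 / m` is again a continuous multiplier, and it inverts
  -- `mulOp m`.
  let n : C(Torus, ℂ) := ⟨fun x => (m x)⁻¹, m.continuous.inv₀ hm⟩
  have hn : coeff (mulOp n torusOne) 0 0 = ∫ x, (m x)⁻¹ ∂torusMeasure := by
    rw [coeff_zero_zero_eq_integral]
    refine integral_congr_ae ?_
    filter_upwards [coeFn_mulOp n torusOne, coeFn_torusOne] with x h1 h2
    rw [h1, h2, mul_one]
    rfl
  have hinv : ∀ g, mulOp m (mulOp n g) = g := fun g => by
    refine Lp.ext ?_
    filter_upwards [coeFn_mulOp m (mulOp n g), coeFn_mulOp n g] with x h1 h2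
    rw [h1, h2]
    exact mul_inv_cancel_left₀ (hm x) _
  have hone : torusOne ≠ 0 := fun h => by
    have := coeff_torusOne 0 0
    rw [h, coeff_zero] at this
    simp at this
  constructor
  · rintro ⟨g, hg, h⟩
    rw [perturbedMulOp_apply] at h
    -- If the mean of `g` vanished, the rank one term would drop out and leave `m g = 0`.
    have hc : coeff g 0 0 ≠ 0 := fun hc => hg (mulOp_eq_zero hm (by simpa [hc] using h))
    have h1 : g + (κ * coeff g 0 0) • mulOp n torusOne = 0 :=
      mulOp_eq_zero hm (by rw [map_add, map_smul, hinv, h])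
    have h2 : coeff (g + (κ * coeff g 0 0) • mulOp n torusOne) 0 0 = 0 := by rw [h1, coeff_zero]
    rw [coeff_add, coeff_smul, hn] at h2
    refine (mul_eq_zero.1 ?_).resolve_left hc
    linear_combination h2
  · intro h
    -- The kernel is spanned by `1 / m`, as the first implication shows.
    refine ⟨mulOp n torusOne, fun h0 => hone ?_, ?_⟩
    · rw [← hinv torusOne, h0, map_zero]
    · rw [perturbedMulOp_apply, hinv, hn]
      have : (1 : ℂ) • torusOne + (κ * ∫ x, (m x)⁻¹ ∂torusMeasure) • torusOne = 0 := by
        rw [← add_smul, h, zero_smul]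
      simpa using this

/-! ### Zeros of the multiplier and the Fredholm property -/

theorem inner_mulOp {m : C(Torus, ℂ)} (hm : ∀ x, star (m x) = m x) (g h : TorusL2) :
    inner ℂ (mulOp m g) h = inner ℂ g (mulOp m h) := by
  rw [L2.inner_def, L2.inner_def]
  refine integral_congr_ae ?_
  filter_upwards [coeFn_mulOp m g, coeFn_mulOp m h] with x h1 h2
  have := hm x
  rw [h1, h2]
  simp only [RCLike.inner_apply, map_mul, starRingEnd_apply, this]
  ring

/-- Multiplication by a real function and a real multiple of `⟨1, ·⟩ 1` are both symmetric. This
makes the kernel orthogonal to the range. -/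
theorem inner_perturbedMulOp {m : C(Torus, ℂ)} (hm : ∀ x, star (m x) = m x) {κ : ℂ}
    (hκ : star κ = κ) (g h : TorusL2) :
    inner ℂ (perturbedMulOp m κ g) h = inner ℂ g (perturbedMulOp m κ h) := by
  rw [perturbedMulOp_apply, perturbedMulOp_apply, inner_add_left, inner_add_right,
    inner_mulOp hm, inner_smul_left, inner_smul_right, coeff_zero_zero_eq_inner,
    coeff_zero_zero_eq_inner, map_mul, inner_conj_symm]
  simp only [starRingEnd_apply, hκ]
  ring

/-- A bounded operator with closed range has bounded partial inverses. -/
theorem exists_preimage_norm_le_of_isClosed_range {E F : Type*} [NormedAddCommGroup E]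
    [NormedSpace ℂ E] [CompleteSpace E] [NormedAddCommGroup F] [NormedSpace ℂ F] [CompleteSpace F]
    (T : E →L[ℂ] F) (hT : IsClosed (range T)) :
    ∃ C > 0, ∀ g, ∃ x, T x = T g ∧ ‖x‖ ≤ C * ‖T g‖ := by
  -- A closed range is a Banach space, so the open mapping theorem applies to `T` as a map onto its
  -- range.
  have : CompleteSpace (LinearMap.range T.toLinearMap) := by
    refine IsClosed.completeSpace_coe (hs := ?_)
    exact hT
  let S : E →L[ℂ] LinearMap.range T.toLinearMap :=
    T.codRestrict (LinearMap.range T.toLinearMap) fun x => ⟨x, rfl⟩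
  have hS : Function.Surjective S := by
    rintro ⟨_, x, rfl⟩
    exact ⟨x, rfl⟩
  obtain ⟨C, hC, h⟩ := S.exists_preimage_norm_le hS
  refine ⟨C, hC, fun g => ?_⟩
  obtain ⟨x, hx, hxn⟩ := h (S g)
  exact ⟨x, congrArg Subtype.val hx, hxn⟩

/-- The torus has no isolated points; what has to be checked is that the circle has more than one
point, as `1/2` is not an integer. -/
theorem infinite_of_isOpen_torus {V : Set Torus} (hV : IsOpen V) (hne : V.Nonempty) :
    V.Infinite := by
  have : Nontrivial UnitAddCircle := by
    refine ⟨0, ((1 / 2 : ℝ) : UnitAddCircle), fun h => ?_⟩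
    have := (AddCircle.coe_eq_zero_iff (1 : ℝ)).1 h.symm
    obtain ⟨n, hn⟩ := this
    have h2 : (n : ℝ) * 2 = 1 := by
      rw [zsmul_eq_mul] at hn
      linarith
    have h3 : n * 2 = 1 := by exact_mod_cast h2
    omega
  obtain ⟨x, hx⟩ := hne
  exact infinite_of_mem_nhds x (hV.mem_nhds hx)

/-- For a finite-dimensional space `K` of square integrable functions on the torus and a non-empty
open set `V`, some non-zero function vanishing outside of `V` is orthogonal to `K`. -/
theorem exists_orthogonal_of_isOpen {V : Set Torus} (hV : IsOpen V) (hne : V.Nonempty)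
    (K : Submodule ℂ TorusL2) [FiniteDimensional ℂ K] :
    ∃ g : TorusL2, g ≠ 0 ∧ (∀ᵐ x ∂torusMeasure, x ∉ V → g x = 0) ∧ ∀ h ∈ K, inner ℂ h g = 0 := by
  have : Infinite V := (infinite_of_isOpen_torus hV hne).to_subtype
  obtain ⟨U, hUi, hUo, hUd⟩ := exists_seq_infinite_isOpen_pairwise_disjoint V
  let W : ℕ → Set Torus := fun n => Subtype.val '' U n
  have hWo : ∀ n, IsOpen (W n) := fun n => hV.isOpenMap_subtype_val _ (hUo n)
  have hWV : ∀ n, W n ⊆ V := fun n => by rintro _ ⟨y, _, rfl⟩; exact y.2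
  have hWd : Pairwise (Function.onFun Disjoint W) := fun i j hij =>
    (disjoint_image_iff Subtype.val_injective).2 (hUd hij)
  -- Indicators of infinitely many disjoint open subsets of `V` are orthogonal and non-zero, so they
  -- span an infinite-dimensional space of functions vanishing outside `V`.
  let w : ℕ → TorusL2 := fun n => indicatorConstLp 2 (hWo n).measurableSet (measure_ne_top _ _) 1
  have hw0 : ∀ n, inner ℂ (w n) (w n) ≠ (0 : ℂ) := fun n => by
    rw [inner_self_ne_zero, ← norm_ne_zero_iff, norm_indicatorConstLp two_ne_zero ENNReal.ofNat_ne_top]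
    have : 0 < torusMeasure.real (W n) :=
      ENNReal.toReal_pos ((hWo n).measure_pos _ ((hUi n).nonempty.image _)).ne' (measure_ne_top _ _)
    rw [norm_one, one_mul]
    exact (Real.rpow_pos_of_pos this _).ne'
  have hwd : ∀ i j, i ≠ j → inner ℂ (w i) (w j) = (0 : ℂ) := fun i j hij => by
    rw [L2.inner_def]
    refine (integral_congr_ae (g := 0) ?_).trans (integral_zero' _ _)
    filter_upwards [indicatorConstLp_coeFn (p := 2) (hs := (hWo i).measurableSet)
      (hμs := measure_ne_top torusMeasure _) (c := (1 : ℂ)),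
      indicatorConstLp_coeFn (p := 2) (hs := (hWo j).measurableSet)
      (hμs := measure_ne_top torusMeasure _) (c := (1 : ℂ))] with x h1 h2
    rw [h1, h2]
    by_cases hx : x ∈ W i
    · have : x ∉ W j := fun h => (hWd hij).le_bot ⟨hx, h⟩
      simp [this]
    · simp [hx]
  have hli : LinearIndependent ℂ w := linearIndependent_of_ne_zero_of_inner_eq_zero
    (fun n h => hw0 n (by rw [h, inner_zero_left])) fun i j hij => hwd i j hij
  -- Projecting these combinations to the finite-dimensional `K` cannot be injective; a non-zero
  -- element of the kernel is the function sought.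
  let L : (ℕ →₀ ℂ) →ₗ[ℂ] K := K.orthogonalProjectionOnto.toLinearMap ∘ₗ Finsupp.linearCombination ℂ w
  have hL : ¬ Function.Injective L := fun h => by
    have h1 := Module.Finite.of_injective L h
    have h2 := (Module.Finite.finite_basis (Finsupp.basisSingleOne (R := ℂ) (ι := ℕ)))
    exact not_finite ℕ
  rw [← LinearMap.ker_eq_bot, Submodule.eq_bot_iff] at hL
  push Not at hL
  obtain ⟨c, hc, hc0⟩ := hL
  refine ⟨Finsupp.linearCombination ℂ w c, fun h => hc0 ?_, ?_, ?_⟩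
  · exact (linearIndependent_iff.1 hli) c h
  · have hsupp : ∀ n, ∀ᵐ x ∂torusMeasure, x ∉ V → w n x = 0 := fun n => by
      filter_upwards [indicatorConstLp_coeFn (p := 2) (hs := (hWo n).measurableSet)
        (hμs := measure_ne_top torusMeasure _) (c := (1 : ℂ))] with x h1 hx
      rw [h1, indicator_of_notMem fun h => hx (hWV n h)]
    refine Finsupp.induction_linear c ?_ ?_ ?_
    · rw [map_zero]
      filter_upwards [Lp.coeFn_zero ℂ 2 torusMeasure] with x hx _
      exact hx
    · intro f g hf hg
      rw [map_add]
      filter_upwards [hf, hg, Lp.coeFn_add (Finsupp.linearCombination ℂ w f)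
        (Finsupp.linearCombination ℂ w g)] with x h1 h2 h3 hx
      rw [h3, Pi.add_apply, h1 hx, h2 hx, add_zero]
    · intro n z
      rw [Finsupp.linearCombination_single]
      filter_upwards [hsupp n, Lp.coeFn_smul z (w n)] with x h1 h2 hx
      rw [h2, Pi.smul_apply, h1 hx, smul_zero]
  · intro h hh
    have := (K.orthogonalProjectionOnto_eq_zero_iff (v := Finsupp.linearCombination ℂ w c)).1 hc
    exact this h hh

/-- If `m` has a zero, then `m + κ ⟨1, ·⟩ 1` does not have both a closed range and a
finite-dimensional kernel. -/
theorem ne_zero_of_isClosed_range {m : C(Torus, ℂ)} {κ : ℂ}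
    (hcl : IsClosed (range (perturbedMulOp m κ)))
    (hker : FiniteDimensional ℂ (LinearMap.ker (perturbedMulOp m κ).toLinearMap)) (x : Torus) :
    m x ≠ 0 := by
  intro hx
  obtain ⟨C, hC, h⟩ := exists_preimage_norm_le_of_isClosed_range _ hcl
  -- Chosen so that `C ε = 1/2`, which contradicts the final estimate `‖g‖ ≤ C ε ‖g‖`.
  set ε : ℝ := 1 / (2 * C) with hε
  have hε0 : 0 < ε := by positivity
  let V : Set Torus := {y | ‖m y‖ < ε}
  have hV : IsOpen V := isOpen_lt m.continuous.norm continuous_const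
  -- Orthogonality to `1` removes the rank one term from `T g`; orthogonality to the kernel makes
  -- `g` the shortest preimage of `T g`.
  obtain ⟨g, hg0, hgV, hgK⟩ := exists_orthogonal_of_isOpen hV ⟨x, by simpa [V, hx] using hε0⟩
    (LinearMap.ker (perturbedMulOp m κ).toLinearMap ⊔ Submodule.span ℂ {torusOne})
  have h1 : coeff g 0 0 = 0 := by
    rw [coeff_zero_zero_eq_inner]
    exact hgK _ (Submodule.mem_sup_right (Submodule.mem_span_singleton_self _))
  have hT : perturbedMulOp m κ g = mulOp m g := by
    rw [perturbedMulOp_apply, h1, mul_zero, zero_smul, add_zero]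
  have hn : ‖mulOp m g‖ ≤ ε * ‖g‖ := by
    refine Lp.norm_le_mul_norm_of_ae_le_mul ?_
    filter_upwards [coeFn_mulOp m g, hgV] with y h1 h2
    rw [h1, norm_mul]
    by_cases hy : y ∈ V
    · exact mul_le_mul_of_nonneg_right (le_of_lt hy) (norm_nonneg _)
    · simp [h2 hy]
  obtain ⟨y, hy, hyn⟩ := h g
  -- The difference of two preimages is in the kernel, so `⟨g, g⟩ = ⟨y, g⟩` and therefore `‖g‖ ≤
  -- ‖y‖`.
  have horth : inner ℂ (g - y) g = (0 : ℂ) := hgK _ (Submodule.mem_sup_left (by simp [hy]))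
  have hgy : ‖g‖ * ‖g‖ ≤ ‖y‖ * ‖g‖ := by
    rw [inner_sub_left, sub_eq_zero] at horth
    have h2 := norm_inner_le_norm (𝕜 := ℂ) y g
    rw [← horth, inner_self_eq_norm_sq_to_K] at h2
    simpa [sq] using h2
  have hgpos : 0 < ‖g‖ := norm_pos_iff.2 hg0
  have h3 : ‖g‖ ≤ C * (ε * ‖g‖) := (le_of_mul_le_mul_right hgy hgpos).trans
    (hyn.trans (by rw [hT]; exact mul_le_mul_of_nonneg_left hn hC.le))
  have h4 : C * (ε * ‖g‖) = ‖g‖ / 2 := by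
    rw [hε]
    field_simp
  linarith

end Torus

/-! ### The symbol of the vertex equation -/

section Symbol

attribute [local instance] isProbabilityMeasure_torusMeasure isOpenPosMeasure_torusMeasure

/-- The trigonometric polynomial `2 A cos (2 π x₀) + 2 B cos (2 π x₁) + C`. -/
noncomputable def cosineSymbol (A B C : ℂ) : C(Torus, ℂ) :=
  A • (UnitAddTorus.mFourier ![1, 0] + UnitAddTorus.mFourier ![-1, 0]) +
    B • (UnitAddTorus.mFourier ![0, 1] + UnitAddTorus.mFourier ![0, -1]) +
    C • UnitAddTorus.mFourier ![0, 0]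

theorem coeff_mulOp_cosineSymbol (A B C : ℂ) (g : TorusL2) (k l : ℤ) :
    coeff (mulOp (cosineSymbol A B C) g) k l =
      A * (coeff g (k - 1) l + coeff g (k + 1) l) + B * (coeff g k (l - 1) + coeff g k (l + 1)) +
        C * coeff g k l := by
  simp only [cosineSymbol, map_add, map_smul, add_apply,
    smul_apply, coeff_add, coeff_smul, coeff_mulOp_mFourier, sub_zero,
    sub_neg_eq_add]

/-- The point of the torus with the given coordinates. -/
def torusPoint (p : Fin 2 → ℝ) : Torus := fun i => (p i : UnitAddCircle)

theorem torusPoint_surjective : Function.Surjective torusPoint := fun x => by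
  choose p hp using fun i => QuotientAddGroup.mk_surjective (x i)
  exact ⟨p, funext hp⟩

theorem mFourier_torusPoint (i j : ℤ) (p : Fin 2 → ℝ) :
    UnitAddTorus.mFourier ![i, j] (torusPoint p) =
      Complex.exp (i * (2 * Real.pi * p 0 : ℝ) * Complex.I) *
        Complex.exp (j * (2 * Real.pi * p 1 : ℝ) * Complex.I) := by
  simp only [UnitAddTorus.mFourier, ContinuousMap.coe_mk, Fin.prod_univ_two, torusPoint,
    fourier_coe_apply]
  congr 2 <;> push_cast <;> simp <;> ring

theorem cosineSymbol_torusPoint (A B C : ℝ) (p : Fin 2 → ℝ) :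
    cosineSymbol A B C (torusPoint p) =
      ((2 * A * Real.cos (2 * Real.pi * p 0) + 2 * B * Real.cos (2 * Real.pi * p 1) + C : ℝ) : ℂ) := by
  simp only [cosineSymbol, ContinuousMap.add_apply, ContinuousMap.smul_apply, mFourier_torusPoint,
    Complex.ofReal_add, Complex.ofReal_mul, Complex.ofReal_cos, Complex.cos, smul_eq_mul]
  push_cast
  simp only [zero_mul, Complex.exp_zero, one_mul, mul_one, neg_mul]
  ring

/-- The multiplier of the vertex equation, with values `2 ω (f - φ)`. -/
noncomputable def vertexSymbol (a₁ a₂ a₃ β ω : ℝ) : C(Torus, ℂ) :=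
  cosineSymbol (ω / Real.sin (ω * a₁) : ℝ) (ω / Real.sin (ω * a₂) : ℝ)
    (-2 * ω * (Real.cos (ω * a₁) / Real.sin (ω * a₁) + Real.cos (ω * a₂) / Real.sin (ω * a₂)
      + phi a₃ β ω) : ℝ)

theorem vertexSymbol_torusPoint (a₁ a₂ a₃ β ω : ℝ) (p : Fin 2 → ℝ) :
    vertexSymbol a₁ a₂ a₃ β ω (torusPoint p) =
      ((-2 * ω * (phi a₃ β ω -
        symbolF a₁ a₂ (2 * Real.pi * p 0) (2 * Real.pi * p 1) ω) : ℝ) : ℂ) := by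
  rw [vertexSymbol, cosineSymbol_torusPoint, symbolF]
  congr 1
  ring

theorem star_vertexSymbol (a₁ a₂ a₃ β ω : ℝ) (x : Torus) :
    star (vertexSymbol a₁ a₂ a₃ β ω x) = vertexSymbol a₁ a₂ a₃ β ω x := by
  obtain ⟨p, rfl⟩ := torusPoint_surjective x
  rw [vertexSymbol_torusPoint]
  exact Complex.conj_ofReal _

theorem vertexSymbol_ne_zero_iff {a₁ a₂ a₃ β ω : ℝ} (hω : ω ≠ 0) :
    (∀ x, vertexSymbol a₁ a₂ a₃ β ω x ≠ 0) ↔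
      ∀ ξ η : ℝ, phi a₃ β ω - symbolF a₁ a₂ ξ η ω ≠ 0 := by
  have hπ := Real.pi_ne_zero
  constructor
  · intro h ξ η h0
    refine h (torusPoint ![ξ / (2 * Real.pi), η / (2 * Real.pi)]) ?_
    rw [vertexSymbol_torusPoint]
    have h1 : 2 * Real.pi * (ξ / (2 * Real.pi)) = ξ := by field_simp
    have h2 : 2 * Real.pi * (η / (2 * Real.pi)) = η := by field_simp
    simp [h1, h2, h0]
  · intro h x
    obtain ⟨p, rfl⟩ := torusPoint_surjective x
    rw [vertexSymbol_torusPoint, Complex.ofReal_ne_zero]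
    exact mul_ne_zero (mul_ne_zero (by norm_num) hω) (h _ _)

/-! ### The torus average -/

open scoped Pointwise in
/-- The average over the torus, as an integral over `(0, 2π)²`. -/
theorem integral_torus_eq {G : Torus → ℂ} {F : ℝ × ℝ → ℂ}
    (h : ∀ p : Fin 2 → ℝ, G (torusPoint p) = F (2 * Real.pi * p 0, 2 * Real.pi * p 1)) :
    ∫ x, G x ∂torusMeasure = (1 / (4 * Real.pi ^ 2) : ℝ) *
      ∫ p in Ioo 0 (2 * Real.pi) ×ˢ Ioo 0 (2 * Real.pi), F p := by
  have hπ := Real.pi_pos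
  refine (UnitAddTorus.integral_preimage G 0).trans ?_
  have h1 : ∀ p : Fin 2 → ℝ, G (fun i => (p i : UnitAddCircle)) =
      F ((2 * Real.pi) • MeasurableEquiv.finTwoArrow p) := h
  simp only [h1]
  have h2 : {x : Fin 2 → ℝ | ∀ i, x i ∈ Ioc ((0 : Fin 2 → ℝ) i) ((0 : Fin 2 → ℝ) i + 1)} =
      MeasurableEquiv.finTwoArrow ⁻¹' (Ioc (0 : ℝ) 1 ×ˢ Ioc (0 : ℝ) 1) := by
    ext x
    simp [Fin.forall_fin_two]
  -- The integral over the fundamental domain `(0, 1]²` is rescaled by `2π` in the plane, which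
  -- yields the factor `(2π)⁻²`.
  rw [h2, (volume_preserving_finTwoArrow ℝ).setIntegral_preimage_emb
    (MeasurableEquiv.measurableEmbedding _) (fun q : ℝ × ℝ => F ((2 * Real.pi) • q)),
    Measure.setIntegral_comp_smul_of_pos volume F _ (by positivity : 0 < 2 * Real.pi)]
  have h3 : (2 * Real.pi) • (Ioc (0 : ℝ) 1 ×ˢ Ioc (0 : ℝ) 1) =
      Ioc 0 (2 * Real.pi) ×ˢ Ioc 0 (2 * Real.pi) := by
    ext ⟨x, y⟩
    rw [mem_smul_set_iff_inv_smul_mem₀ (by positivity)]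
    simp only [Prod.smul_mk, smul_eq_mul, mem_prod, mem_Ioc, inv_mul_le_iff₀ (by positivity : 0 < 2 * Real.pi), mul_one]
    have : ∀ z : ℝ, 0 < (2 * Real.pi)⁻¹ * z ↔ 0 < z := fun z =>
      mul_pos_iff_of_pos_left (by positivity)
    simp only [this]
  have h4 : (Ioo 0 (2 * Real.pi) ×ˢ Ioo 0 (2 * Real.pi) : Set (ℝ × ℝ)) =ᵐ[volume]
      Ioc 0 (2 * Real.pi) ×ˢ Ioc 0 (2 * Real.pi) :=
    Measure.set_prod_ae_eq Ioo_ae_eq_Ioc Ioo_ae_eq_Ioc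
  rw [h3, ← setIntegral_congr_set h4, Module.finrank_prod, Module.finrank_self, Complex.real_smul]
  congr 2
  rw [one_div]
  congr 1
  ring

theorem continuous_symbolF (a₁ a₂ ω : ℝ) :
    Continuous fun p : ℝ × ℝ => symbolF a₁ a₂ p.1 p.2 ω := by
  unfold symbolF
  fun_prop

theorem continuous_criterion {a₁ a₂ a₃ β ω : ℝ}
    (h : ∀ ξ η : ℝ, phi a₃ β ω - symbolF a₁ a₂ ξ η ω ≠ 0) :
    Continuous fun p : ℝ × ℝ => phi a₃ β ω / (phi a₃ β ω - symbolF a₁ a₂ p.1 p.2 ω) :=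
  continuous_const.div (continuous_const.sub (continuous_symbolF a₁ a₂ ω)) fun p => h p.1 p.2

theorem integrableOn_criterion {a₁ a₂ a₃ β ω : ℝ}
    (h : ∀ ξ η : ℝ, phi a₃ β ω - symbolF a₁ a₂ ξ η ω ≠ 0) :
    IntegrableOn (fun p : ℝ × ℝ => phi a₃ β ω / (phi a₃ β ω - symbolF a₁ a₂ p.1 p.2 ω))
      (Ioo 0 (2 * Real.pi) ×ˢ Ioo 0 (2 * Real.pi)) := by
  refine ((continuous_criterion h).continuousOn.integrableOn_compact
    (isCompact_Icc.prod isCompact_Icc)).mono_set (prod_mono Ioo_subset_Icc_self Ioo_subset_Icc_self)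

/-- At `(ω a₁, ω a₂)` the function `f` vanishes, so `φ ≠ 0` and the ratio equals `1` there. Being
continuous and without zeros, it is positive everywhere by the intermediate value theorem. -/
theorem torusAverage_pos {a₁ a₂ a₃ β ω : ℝ}
    (h : ∀ ξ η : ℝ, phi a₃ β ω - symbolF a₁ a₂ ξ η ω ≠ 0) : 0 < torusAverage a₁ a₂ a₃ β ω := by
  have hf : symbolF a₁ a₂ (ω * a₁) (ω * a₂) ω = 0 := by simp [symbolF]
  have hφ : phi a₃ β ω ≠ 0 := by simpa [hf] using h (ω * a₁) (ω * a₂)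
  have hpos : ∀ p : ℝ × ℝ, 0 < phi a₃ β ω / (phi a₃ β ω - symbolF a₁ a₂ p.1 p.2 ω) := by
    intro p
    by_contra! hp
    obtain ⟨q, hq⟩ := mem_range_of_exists_le_of_exists_ge (continuous_criterion h) ⟨p, hp⟩
      ⟨(ω * a₁, ω * a₂), by simp [hf, hφ]⟩
    exact div_ne_zero hφ (h q.1 q.2) hq
  have hπ := Real.pi_pos
  refine mul_pos (by positivity) ?_
  rw [setIntegral_pos_iff_support_of_nonneg_ae (.of_forall fun p => (hpos p).le)
    (integrableOn_criterion h)]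
  have hs : Function.support
      (fun p : ℝ × ℝ => phi a₃ β ω / (phi a₃ β ω - symbolF a₁ a₂ p.1 p.2 ω)) = univ :=
    eq_univ_of_forall fun p => (hpos p).ne'
  rw [hs, univ_inter]
  exact (isOpen_Ioo.prod isOpen_Ioo).measure_pos _
    ((nonempty_Ioo.2 (by positivity)).prod (nonempty_Ioo.2 (by positivity)))

/-- The symbol is `m = -2ω(φ - f)`, so `φ / (φ - f) = -2ωφ / m` pointwise. -/
theorem torusAverage_eq {a₁ a₂ a₃ β ω : ℝ} (hω : ω ≠ 0) :
    (torusAverage a₁ a₂ a₃ β ω : ℂ) =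
      -2 * ω * phi a₃ β ω * ∫ x, (vertexSymbol a₁ a₂ a₃ β ω x)⁻¹ ∂torusMeasure := by
  rw [← integral_const_mul, integral_torus_eq (F := fun p =>
    ((phi a₃ β ω / (phi a₃ β ω - symbolF a₁ a₂ p.1 p.2 ω) : ℝ) : ℂ)), torusAverage,
    integral_complex_ofReal, Complex.ofReal_mul]
  intro p
  rw [vertexSymbol_torusPoint]
  have : (ω : ℂ) ≠ 0 := by exact_mod_cast hω
  push_cast
  rw [mul_inv, div_eq_mul_inv]
  field_simp

/-- The operator of the vertex equation. -/
noncomputable def vertexOp (a₁ a₂ a₃ β μ ω : ℝ) : TorusL2 →L[ℂ] TorusL2 :=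
  perturbedMulOp (vertexSymbol a₁ a₂ a₃ β ω) ((-2 * ω * (μ - 1) * phi a₃ β ω : ℝ) : ℂ)

/-- For `κ = -2ω(μ - 1)φ` the solvability condition `1 + κ ∫ 1/m = 0` is `1 + (μ - 1) · average =
0`, and the average is the inverse of `F`. -/
theorem exists_vertexOp_eq_zero_iff {a₁ a₂ a₃ β μ ω : ℝ} (hω : ω ≠ 0)
    (h : ∀ ξ η : ℝ, phi a₃ β ω - symbolF a₁ a₂ ξ η ω ≠ 0) :
    (∃ g, g ≠ 0 ∧ vertexOp a₁ a₂ a₃ β μ ω g = 0) ↔ μ = 1 - bigF a₁ a₂ a₃ β ω := by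
  rw [vertexOp, exists_perturbedMulOp_eq_zero_iff ((vertexSymbol_ne_zero_iff hω).2 h)]
  have h1 : (1 : ℂ) + ((-2 * ω * (μ - 1) * phi a₃ β ω : ℝ) : ℂ) *
      ∫ x, (vertexSymbol a₁ a₂ a₃ β ω x)⁻¹ ∂torusMeasure =
      ((1 + (μ - 1) * torusAverage a₁ a₂ a₃ β ω : ℝ) : ℂ) := by
    push_cast
    rw [torusAverage_eq hω]
    ring
  rw [h1, Complex.ofReal_eq_zero, bigF]
  have hne := (torusAverage_pos h).ne'
  constructor
  · intro h2
    field_simp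
    linarith
  · intro h2
    rw [h2]
    field_simp
    ring

/-- The rank one term acts on the coefficient at the origin only, where it raises the weight of the
`φ` term from `1` to `μ`. -/
theorem coeff_vertexOp (a₁ a₂ a₃ β μ ω : ℝ) (g : TorusL2) (k l : ℤ) :
    coeff (vertexOp a₁ a₂ a₃ β μ ω g) k l =
      ω / Real.sin (ω * a₁) * (coeff g (k - 1) l + coeff g (k + 1) l
        - 2 * Real.cos (ω * a₁) * coeff g k l) +
      ω / Real.sin (ω * a₂) * (coeff g k (l - 1) + coeff g k (l + 1)
        - 2 * Real.cos (ω * a₂) * coeff g k l) -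
      2 * ω * vertexWeight μ k l * phi a₃ β ω * coeff g k l := by
  rw [vertexOp, perturbedMulOp_apply, coeff_add, coeff_smul, coeff_torusOne, vertexSymbol,
    coeff_mulOp_cosineSymbol]
  by_cases h : k = 0 ∧ l = 0
  · obtain ⟨rfl, rfl⟩ := h
    simp only [vertexWeight, and_self, if_true]
    push_cast
    ring
  · simp only [vertexWeight, h, if_false]
    push_cast
    ring

end Symbol

/-! ### Solutions of `-u'' = ω² u` on the graph -/

section VertexEquation

/-- The Dirichlet-to-Neumann map of an edge: `A`, `B` are the end values, `P`, `Q` the end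
derivatives, and `s`, `c` the sine and cosine of `ω` times the length. -/
theorem derivs_of_endpoint_values {w s c A B P Q : ℂ} (hs : s ≠ 0) (hsc : s ^ 2 + c ^ 2 = 1)
    (h1 : w * B = w * A * c + P * s) (h2 : Q = -w * A * s + P * c) :
    P = w / s * (B - c * A) ∧ Q = w / s * (c * B - A) := by
  rw [div_mul_eq_mul_div, eq_div_iff hs, div_mul_eq_mul_div, eq_div_iff hs]
  constructor
  · linear_combination -h1
  · linear_combination s * h2 - c * h1 - w * A * hsc

/-- The left-hand side of the Kirchhoff condition. -/
noncomputable def kirchhoffSum (a₁ a₂ μ : ℝ) (u' : Edge → ℝ → ℂ) (k l : ℤ) : ℂ :=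
  u' (.horiz₁ k l) (k * a₁) - u' (.horiz₁ (k - 1) l) (k * a₁)
    + u' (.horiz₂ k l) (l * a₂) - u' (.horiz₂ k (l - 1)) (l * a₂)
    + (vertexWeight μ k l : ℂ) * (u' (.up k l) 0 - u' (.down k l) 0)

/-- `u` satisfies all conditions for the eigenfunctions for the eigenvalue `ω²`, except for the
Kirchhoff conditions. -/
structure IsEdgeSolution (a₁ a₂ a₃ β ω : ℝ) (u u' u'' : Edge → ℝ → ℂ) : Prop where
  h2 : IsGraphH2 a₁ a₂ a₃ u u' u''
  quasiperiodic : ∀ k l : ℤ,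
    u (.up k l) (a₃ / 2) = Complex.exp (-(Complex.I * β)) * u (.down k l) (-(a₃ / 2))
  quasiperiodic_deriv : ∀ k l : ℤ,
    u' (.up k l) (a₃ / 2) = Complex.exp (-(Complex.I * β)) * u' (.down k l) (-(a₃ / 2))
  ode : ∀ e : Edge, ∀ᵐ x ∂(volume.restrict (Icc (e.lo a₁ a₂ a₃) (e.hi a₁ a₂ a₃))),
    u'' e x = -(ω : ℂ) ^ 2 * u e x

variable {a₁ a₂ a₃ β μ ω : ℝ} {u u' u'' : Edge → ℝ → ℂ}

namespace IsGraphH2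

/-- The value at a vertex is always read off at the start of its edge `horiz₁`; this lemma and the
next ones bring the other edge ends to that form. -/
theorem horiz₁_hi (h : IsGraphH2 a₁ a₂ a₃ u u' u'') (k l : ℤ) :
    u (.horiz₁ k l) ((k + 1) * a₁) = u (.horiz₁ (k + 1) l) ((k + 1 : ℤ) * a₁) := by
  obtain ⟨c, h1, h2, -⟩ := h.continuous_vertex (k + 1) l
  rw [h1, ← h2, add_sub_cancel_right]
  push_cast
  rfl

theorem horiz₂_lo (h : IsGraphH2 a₁ a₂ a₃ u u' u'') (k l : ℤ) :
    u (.horiz₂ k l) (l * a₂) = u (.horiz₁ k l) (k * a₁) := by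
  obtain ⟨c, h1, -, h3, -⟩ := h.continuous_vertex k l
  rw [h1, h3]

theorem horiz₂_hi (h : IsGraphH2 a₁ a₂ a₃ u u' u'') (k l : ℤ) :
    u (.horiz₂ k l) ((l + 1) * a₂) = u (.horiz₁ k (l + 1)) (k * a₁) := by
  obtain ⟨c, h1, -, -, h4, -⟩ := h.continuous_vertex k (l + 1)
  rw [h1, ← h4, add_sub_cancel_right]
  push_cast
  rfl

theorem up_zero (h : IsGraphH2 a₁ a₂ a₃ u u' u'') (k l : ℤ) :
    u (.up k l) 0 = u (.horiz₁ k l) (k * a₁) := by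
  obtain ⟨c, h1, -, -, -, h5, -⟩ := h.continuous_vertex k l
  rw [h1, h5]

theorem down_zero (h : IsGraphH2 a₁ a₂ a₃ u u' u'') (k l : ℤ) :
    u (.down k l) 0 = u (.horiz₁ k l) (k * a₁) := by
  obtain ⟨c, h1, -, -, -, -, h6⟩ := h.continuous_vertex k l
  rw [h1, h6]

end IsGraphH2

namespace IsEdgeSolution

theorem eq_trig (h : IsEdgeSolution a₁ a₂ a₃ β ω u u' u'') (ha₁ : 0 < a₁) (ha₂ : 0 < a₂)
    (ha₃ : 0 < a₃) (e : Edge) {x : ℝ} (hx : x ∈ Icc (e.lo a₁ a₂ a₃) (e.hi a₁ a₂ a₃)) :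
    ω * u e x = ω * u e (e.lo a₁ a₂ a₃) * Real.cos (ω * (x - e.lo a₁ a₂ a₃)) +
      u' e (e.lo a₁ a₂ a₃) * Real.sin (ω * (x - e.lo a₁ a₂ a₃)) ∧
    u' e x = -ω * u e (e.lo a₁ a₂ a₃) * Real.sin (ω * (x - e.lo a₁ a₂ a₃)) +
      u' e (e.lo a₁ a₂ a₃) * Real.cos (ω * (x - e.lo a₁ a₂ a₃)) :=
  (h.h2.edge e).eq_trig (Edge.lo_lt_hi ha₁ ha₂ ha₃ e).le (h.ode e) x hx

theorem deriv_horiz₁ (h : IsEdgeSolution a₁ a₂ a₃ β ω u u' u'') (ha₁ : 0 < a₁) (ha₂ : 0 < a₂)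
    (ha₃ : 0 < a₃) (hs : Real.sin (ω * a₁) ≠ 0) (k l : ℤ) :
    u' (.horiz₁ k l) (k * a₁) = ω / Real.sin (ω * a₁) * (u (.horiz₁ (k + 1) l) ((k + 1 : ℤ) * a₁)
      - Real.cos (ω * a₁) * u (.horiz₁ k l) (k * a₁)) ∧
    u' (.horiz₁ k l) ((k + 1) * a₁) = ω / Real.sin (ω * a₁) *
      (Real.cos (ω * a₁) * u (.horiz₁ (k + 1) l) ((k + 1 : ℤ) * a₁)
        - u (.horiz₁ k l) (k * a₁)) := by
  obtain ⟨h1, h2⟩ := h.eq_trig ha₁ ha₂ ha₃ (.horiz₁ k l)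
    (right_mem_Icc.2 (Edge.lo_lt_hi ha₁ ha₂ ha₃ _).le)
  have he : ((k : ℝ) + 1) * a₁ - k * a₁ = a₁ := by ring
  simp only [Edge.lo, Edge.hi, he, h.h2.horiz₁_hi] at h1 h2
  have hs' : (Real.sin (ω * a₁) : ℂ) ≠ 0 := by exact_mod_cast hs
  have hsc : (Real.sin (ω * a₁) : ℂ) ^ 2 + (Real.cos (ω * a₁) : ℂ) ^ 2 = 1 := by
    exact_mod_cast Real.sin_sq_add_cos_sq (ω * a₁)
  exact derivs_of_endpoint_values hs' hsc h1 h2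

theorem deriv_horiz₂ (h : IsEdgeSolution a₁ a₂ a₃ β ω u u' u'') (ha₁ : 0 < a₁) (ha₂ : 0 < a₂)
    (ha₃ : 0 < a₃) (hs : Real.sin (ω * a₂) ≠ 0) (k l : ℤ) :
    u' (.horiz₂ k l) (l * a₂) = ω / Real.sin (ω * a₂) * (u (.horiz₁ k (l + 1)) (k * a₁)
      - Real.cos (ω * a₂) * u (.horiz₁ k l) (k * a₁)) ∧
    u' (.horiz₂ k l) ((l + 1) * a₂) = ω / Real.sin (ω * a₂) *
      (Real.cos (ω * a₂) * u (.horiz₁ k (l + 1)) (k * a₁) - u (.horiz₁ k l) (k * a₁)) := by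
  obtain ⟨h1, h2⟩ := h.eq_trig ha₁ ha₂ ha₃ (.horiz₂ k l)
    (right_mem_Icc.2 (Edge.lo_lt_hi ha₁ ha₂ ha₃ _).le)
  have he : ((l : ℝ) + 1) * a₂ - l * a₂ = a₂ := by ring
  simp only [Edge.lo, Edge.hi, he, h.h2.horiz₂_hi, h.h2.horiz₂_lo] at h1 h2
  have hs' : (Real.sin (ω * a₂) : ℂ) ≠ 0 := by exact_mod_cast hs
  have hsc : (Real.sin (ω * a₂) : ℂ) ^ 2 + (Real.cos (ω * a₂) : ℂ) ^ 2 = 1 := by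
    exact_mod_cast Real.sin_sq_add_cos_sq (ω * a₂)
  exact derivs_of_endpoint_values hs' hsc h1 h2

/-- Going up from the vertex, and then along the lower half-edge multiplied by `q = e^{-iβ}`, one
follows a single solution on an interval of length `a₃` with end values `U` and `q U`. The formulas
are its Dirichlet-to-Neumann map, after dividing the second derivative by `q`. -/
theorem deriv_vertical (h : IsEdgeSolution a₁ a₂ a₃ β ω u u' u'') (ha₁ : 0 < a₁) (ha₂ : 0 < a₂)
    (ha₃ : 0 < a₃) (hs : Real.sin (ω * a₃) ≠ 0) (k l : ℤ) :
    u' (.up k l) 0 = ω / Real.sin (ω * a₃) * (Complex.exp (-(Complex.I * β))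
      - Real.cos (ω * a₃)) * u (.horiz₁ k l) (k * a₁) ∧
    u' (.down k l) 0 = ω / Real.sin (ω * a₃) * (Real.cos (ω * a₃)
      - Complex.exp (Complex.I * β)) * u (.horiz₁ k l) (k * a₁) := by
  obtain ⟨h1, h2⟩ := h.eq_trig ha₁ ha₂ ha₃ (.up k l)
    (right_mem_Icc.2 (Edge.lo_lt_hi ha₁ ha₂ ha₃ _).le)
  obtain ⟨h3, h4⟩ := h.eq_trig ha₁ ha₂ ha₃ (.down k l)
    (right_mem_Icc.2 (Edge.lo_lt_hi ha₁ ha₂ ha₃ _).le)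
  have hq := h.quasiperiodic k l
  have hq' := h.quasiperiodic_deriv k l
  simp only [Edge.lo, Edge.hi, sub_zero, zero_sub, neg_neg, h.h2.up_zero, h.h2.down_zero]
    at h1 h2 h3 h4
  have hs' : (Real.sin (ω * a₃) : ℂ) ≠ 0 := by exact_mod_cast hs
  have hsin : (Real.sin (ω * a₃) : ℂ) =
      2 * Real.sin (ω * (a₃ / 2)) * Real.cos (ω * (a₃ / 2)) := by
    rw [show ω * a₃ = 2 * (ω * (a₃ / 2)) by ring, Real.sin_two_mul]
    push_cast
    rfl
  have hcos : (Real.cos (ω * a₃) : ℂ) =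
      (Real.cos (ω * (a₃ / 2)) : ℂ) ^ 2 - (Real.sin (ω * (a₃ / 2)) : ℂ) ^ 2 := by
    rw [show ω * a₃ = 2 * (ω * (a₃ / 2)) by ring, Real.cos_two_mul']
    push_cast
    rfl
  have hsc : (Real.sin (ω * (a₃ / 2)) : ℂ) ^ 2 + (Real.cos (ω * (a₃ / 2)) : ℂ) ^ 2 = 1 := by
    exact_mod_cast Real.sin_sq_add_cos_sq (ω * (a₃ / 2))
  have hqq : Complex.exp (-(Complex.I * β)) * Complex.exp (Complex.I * β) = 1 := by
    rw [← Complex.exp_add, neg_add_cancel, Complex.exp_zero]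
  set q := Complex.exp (-(Complex.I * β))
  set q' := Complex.exp (Complex.I * β)
  set s := (Real.sin (ω * (a₃ / 2)) : ℂ)
  set c := (Real.cos (ω * (a₃ / 2)) : ℂ)
  set U := u (.horiz₁ k l) (k * a₁)
  set A := u (.down k l) (-(a₃ / 2))
  set A' := u' (.down k l) (-(a₃ / 2))
  rw [hq] at h1
  rw [hq'] at h2
  -- The data at the vertex are transported backwards along the lower half-edge; the double angle
  -- formulas then combine the two halves.
  have hA : ω * A = ω * U * c - u' (.down k l) 0 * s := by
    linear_combination -c * h3 + s * h4 - ω * A * hsc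
  have hA' : A' = ω * U * s + u' (.down k l) 0 * c := by
    linear_combination -s * h3 - c * h4 - A' * hsc
  have hP : u' (.up k l) 0 * Real.sin (ω * a₃) = ω * (q - Real.cos (ω * a₃)) * U := by
    rw [hsin, hcos]
    linear_combination -c * h1 - s * h2 + q * c * hA + q * s * hA' + q * ω * U * hsc
  have hM : u' (.down k l) 0 * Real.sin (ω * a₃) = ω * (Real.cos (ω * a₃) - q') * U := by
    rw [hsin, hcos]
    have hE : q * (ω * A * c - A' * s) = ω * U := by
      linear_combination c * h1 - s * h2 + ω * U * hsc
    linear_combination -q' * hE + c * hA - s * hA' + (ω * A * c - A' * s) * hqq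
  constructor
  · rw [div_mul_eq_mul_div, div_mul_eq_mul_div, eq_div_iff hs', hP]
  · rw [div_mul_eq_mul_div, div_mul_eq_mul_div, eq_div_iff hs', hM]

/-- The derivatives at the vertex are inserted from the edge formulas. The vertical edges contribute
`-2ωφ` times the vertex value and the weight, because `e^{iβ} + e^{-iβ} = 2 cos β`. -/
theorem kirchhoffSum_eq (h : IsEdgeSolution a₁ a₂ a₃ β ω u u' u'') (ha₁ : 0 < a₁) (ha₂ : 0 < a₂)
    (ha₃ : 0 < a₃) (hs₁ : Real.sin (ω * a₁) ≠ 0) (hs₂ : Real.sin (ω * a₂) ≠ 0)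
    (hs₃ : Real.sin (ω * a₃) ≠ 0) {g : TorusL2}
    (hg : ∀ k l : ℤ, coeff g k l = u (.horiz₁ k l) (k * a₁)) (k l : ℤ) :
    kirchhoffSum a₁ a₂ μ u' k l = coeff (vertexOp a₁ a₂ a₃ β μ ω g) k l := by
  have e1 := (h.deriv_horiz₁ ha₁ ha₂ ha₃ hs₁ k l).1
  have e2 := (h.deriv_horiz₁ ha₁ ha₂ ha₃ hs₁ (k - 1) l).2
  have e3 := (h.deriv_horiz₂ ha₁ ha₂ ha₃ hs₂ k l).1
  have e4 := (h.deriv_horiz₂ ha₁ ha₂ ha₃ hs₂ k (l - 1)).2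
  obtain ⟨e5, e6⟩ := h.deriv_vertical ha₁ ha₂ ha₃ hs₃ k l
  have hk : (((k - 1 : ℤ) : ℝ) + 1) * a₁ = k * a₁ := by push_cast; ring
  have hl : (((l - 1 : ℤ) : ℝ) + 1) * a₂ = l * a₂ := by push_cast; ring
  rw [hk, sub_add_cancel] at e2
  rw [hl, sub_add_cancel] at e4
  rw [← hg] at e1 e2 e3 e4 e5 e6
  rw [← hg] at e1 e2 e3 e4
  have hs' : (Real.sin (ω * a₃) : ℂ) ≠ 0 := by exact_mod_cast hs₃
  have hφ : (phi a₃ β ω : ℂ) = (Real.cos (ω * a₃) - (Complex.exp (Complex.I * β)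
      + Complex.exp (-(Complex.I * β))) / 2) / Real.sin (ω * a₃) := by
    rw [phi]
    push_cast
    rw [Complex.cos.eq_1 (β : ℂ), mul_comm Complex.I, neg_mul]
  rw [kirchhoffSum, e1, e2, e3, e4, e5, e6, coeff_vertexOp, hφ]
  ring

/-- The vertex values of a solution are square summable. -/
theorem summable_vertex (h : IsEdgeSolution a₁ a₂ a₃ β ω u u' u'') (ha₁ : 0 < a₁) (ha₂ : 0 < a₂)
    (ha₃ : 0 < a₃) (hω : ω ≠ 0) :
    Summable fun p : ℤ × ℤ => ‖u (.horiz₁ p.1 p.2) (p.1 * a₁)‖ ^ 2 := by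
  -- Along an edge the pair `(ω u, u')` is only rotated, so `|ω u| + |u'|` at every point of the
  -- edge dominates `|ω u|` at its start. Integrating over the length `a₁` bounds the vertex values
  -- by `L²` norms.
  have hF : MemLp (fun p : Edge × ℝ => ‖(ω : ℂ) * u p.1 p.2‖ + ‖u' p.1 p.2‖) 2
      (graphMeasure a₁ a₂ a₃ 1) := (h.h2.memLp.const_mul (ω : ℂ)).norm.add h.h2.memLp_deriv.norm
  have hlt := tsum_horiz_lt_top hF
  have hle : ∑' p : ℤ × ℤ, ENNReal.ofReal (a₁ * ω ^ 2 * ‖u (.horiz₁ p.1 p.2) (p.1 * a₁)‖ ^ 2) < ∞ := by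
    refine (ENNReal.tsum_le_tsum fun p => ?_).trans_lt hlt
    have hvol : volume (Icc (p.1 * a₁) ((p.1 + 1) * a₁)) = ENNReal.ofReal a₁ := by
      rw [Real.volume_Icc]
      congr 1
      ring
    have h1 : ∫⁻ x in Icc (p.1 * a₁) ((p.1 + 1) * a₁),
        ENNReal.ofReal (ω ^ 2 * ‖u (.horiz₁ p.1 p.2) (p.1 * a₁)‖ ^ 2) ≤
        ∫⁻ x in Icc (p.1 * a₁) ((p.1 + 1) * a₁), ‖(‖(ω : ℂ) * u (.horiz₁ p.1 p.2) x‖ +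
          ‖u' (.horiz₁ p.1 p.2) x‖)‖ₑ ^ 2 := by
      refine setLIntegral_mono' measurableSet_Icc fun x hx => ?_
      rw [← ofReal_norm, ← ENNReal.ofReal_pow (norm_nonneg _)]
      refine ENNReal.ofReal_le_ofReal ?_
      rw [Real.norm_of_nonneg (by positivity)]
      have h2 : ω ^ 2 * ‖u (.horiz₁ p.1 p.2) (p.1 * a₁)‖ ^ 2 =
          ‖(ω : ℂ) * u (.horiz₁ p.1 p.2) (p.1 * a₁)‖ ^ 2 := by
        rw [norm_mul, mul_pow, Complex.norm_real, Real.norm_eq_abs, sq_abs]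
      rw [h2]
      refine pow_le_pow_left₀ (norm_nonneg _) ?_ 2
      obtain ⟨e1, e2⟩ := h.eq_trig ha₁ ha₂ ha₃ (.horiz₁ p.1 p.2) (x := x)
        (by simpa only [Edge.lo, Edge.hi] using hx)
      simp only [Edge.lo] at e1 e2
      set θ := ω * (x - p.1 * a₁)
      have hsc : (Real.sin θ : ℂ) ^ 2 + (Real.cos θ : ℂ) ^ 2 = 1 := by
        exact_mod_cast Real.sin_sq_add_cos_sq θ
      have h3 : ω * u (.horiz₁ p.1 p.2) (p.1 * a₁) = ω * u (.horiz₁ p.1 p.2) x * Real.cos θ -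
          u' (.horiz₁ p.1 p.2) x * Real.sin θ := by
        linear_combination -(Real.cos θ : ℂ) * e1 + (Real.sin θ : ℂ) * e2 -
          ω * u (.horiz₁ p.1 p.2) (p.1 * a₁) * hsc
      rw [h3]
      refine (norm_sub_le _ _).trans (add_le_add ?_ ?_)
      · rw [norm_mul _ (Real.cos θ : ℂ), Complex.norm_real]
        exact mul_le_of_le_one_right (norm_nonneg _) (Real.abs_cos_le_one _)
      · rw [norm_mul, Complex.norm_real]
        exact mul_le_of_le_one_right (norm_nonneg _) (Real.abs_sin_le_one _)
    rw [lintegral_const, Measure.restrict_apply_univ, hvol,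
      ← ENNReal.ofReal_mul (by positivity)] at h1
    refine le_trans (le_of_eq ?_) h1
    congr 1
    ring
  have hsum := ENNReal.summable_toReal hle.ne
  have hc : a₁ * ω ^ 2 ≠ 0 := by positivity
  refine (summable_mul_left_iff hc).1 (hsum.congr fun p => ?_)
  rw [ENNReal.toReal_ofReal (by positivity)]

theorem exists_coeff_eq_vertex (h : IsEdgeSolution a₁ a₂ a₃ β ω u u' u'') (ha₁ : 0 < a₁)
    (ha₂ : 0 < a₂) (ha₃ : 0 < a₃) (hω : ω ≠ 0) :
    ∃ g : TorusL2, ∀ k l : ℤ, coeff g k l = u (.horiz₁ k l) (k * a₁) :=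
  exists_coeff_eq (h.summable_vertex ha₁ ha₂ ha₃ hω)

/-- A solution that vanishes at the vertices is zero. -/
theorem eq_zero_of_vertex (h : IsEdgeSolution a₁ a₂ a₃ β ω u u' u'') (ha₁ : 0 < a₁)
    (ha₂ : 0 < a₂) (ha₃ : 0 < a₃) (hω : ω ≠ 0) (hs₁ : Real.sin (ω * a₁) ≠ 0)
    (hs₂ : Real.sin (ω * a₂) ≠ 0) (hs₃ : Real.sin (ω * a₃) ≠ 0)
    (h0 : ∀ k l : ℤ, u (.horiz₁ k l) (k * a₁) = 0) (e : Edge) {x : ℝ}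
    (hx : x ∈ Icc (e.lo a₁ a₂ a₃) (e.hi a₁ a₂ a₃)) : u e x = 0 := by
  have hω' : (ω : ℂ) ≠ 0 := by exact_mod_cast hω
  have hup : ∀ k l, u (.up k l) 0 = 0 ∧ u' (.up k l) 0 = 0 := fun k l =>
    ⟨by rw [h.h2.up_zero, h0], by rw [(h.deriv_vertical ha₁ ha₂ ha₃ hs₃ k l).1, h0, mul_zero]⟩
  have key : u e (e.lo a₁ a₂ a₃) = 0 ∧ u' e (e.lo a₁ a₂ a₃) = 0 := by
    cases e with
    | horiz₁ k l =>
      refine ⟨h0 k l, ?_⟩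
      rw [Edge.lo, (h.deriv_horiz₁ ha₁ ha₂ ha₃ hs₁ k l).1, h0, h0]
      ring
    | horiz₂ k l =>
      refine ⟨by rw [Edge.lo, h.h2.horiz₂_lo, h0], ?_⟩
      rw [Edge.lo, (h.deriv_horiz₂ ha₁ ha₂ ha₃ hs₂ k l).1, h0, h0]
      ring
    | up k l => exact hup k l
    | down k l =>
      -- The lower edge starts at `-a₃/2`, where quasiperiodicity gives its data from the top of the
      -- upper edge, which are zero.
      obtain ⟨e1, e2⟩ := h.eq_trig ha₁ ha₂ ha₃ (.up k l)
        (right_mem_Icc.2 (Edge.lo_lt_hi ha₁ ha₂ ha₃ _).le)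
      simp only [Edge.lo, Edge.hi, (hup k l).1, (hup k l).2, mul_zero, zero_mul, add_zero] at e1 e2
      rw [h.quasiperiodic_deriv] at e2
      have e1 := (mul_eq_zero.1 e1).resolve_left hω'
      rw [h.quasiperiodic] at e1
      exact ⟨(mul_eq_zero.1 e1).resolve_left (Complex.exp_ne_zero _),
        (mul_eq_zero.1 e2).resolve_left (Complex.exp_ne_zero _)⟩
  have h1 := (h.eq_trig ha₁ ha₂ ha₃ e hx).1
  rw [key.1, key.2] at h1
  simpa [hω'] using h1

end IsEdgeSolution

end VertexEquation

/-! ### Solutions with given vertex values -/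

section Interpolation

theorem trigSolution_self (ω s : ℝ) (α γ : ℂ) : trigSolution ω s α γ s = α := by
  simp [trigSolution]

theorem trigSolution_eq {ω s x d : ℝ} (h : x - s = d) (α γ : ℂ) :
    trigSolution ω s α γ x = α * Real.cos (ω * d) + γ * Real.sin (ω * d) := by
  rw [trigSolution, h]

/-- The initial values on the edges of the solution with vertex values `U`. -/
noncomputable def initialValue (a₃ β ω : ℝ) (U : ℤ → ℤ → ℂ) : Edge → ℂ
  | .horiz₁ k l => U k l
  | .horiz₂ k l => U k l
  | .up k l => U k l
  -- The lower edge starts at `-a₃/2`, so its data are `e^{iβ}` times those of the upper solution at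
  -- `a₃/2`.
  | .down k l => Complex.exp (Complex.I * β) * (U k l * Real.cos (ω * (a₃ / 2)) +
      (Complex.exp (-(Complex.I * β)) - Real.cos (ω * a₃)) / Real.sin (ω * a₃) * U k l *
        Real.sin (ω * (a₃ / 2)))

/-- The initial derivatives, divided by `ω`, of the solution with vertex values `U`. -/
noncomputable def initialSlope (a₁ a₂ a₃ β ω : ℝ) (U : ℤ → ℤ → ℂ) : Edge → ℂ
  | .horiz₁ k l => (U (k + 1) l - Real.cos (ω * a₁) * U k l) / Real.sin (ω * a₁)
  | .horiz₂ k l => (U k (l + 1) - Real.cos (ω * a₂) * U k l) / Real.sin (ω * a₂)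
  | .up k l => (Complex.exp (-(Complex.I * β)) - Real.cos (ω * a₃)) / Real.sin (ω * a₃) * U k l
  | .down k l => Complex.exp (Complex.I * β) * (-U k l * Real.sin (ω * (a₃ / 2)) +
      (Complex.exp (-(Complex.I * β)) - Real.cos (ω * a₃)) / Real.sin (ω * a₃) * U k l *
        Real.cos (ω * (a₃ / 2)))

/-- The solution with vertex values `U`. -/
noncomputable def interpolation (a₁ a₂ a₃ β ω : ℝ) (U : ℤ → ℤ → ℂ) (e : Edge) : ℝ → ℂ :=
  trigSolution ω (e.lo a₁ a₂ a₃) (initialValue a₃ β ω U e) (initialSlope a₁ a₂ a₃ β ω U e)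

/-- The derivative of the solution with vertex values `U`. -/
noncomputable def interpolationDeriv (a₁ a₂ a₃ β ω : ℝ) (U : ℤ → ℤ → ℂ) (e : Edge) (x : ℝ) : ℂ :=
  ω * trigSolution ω (e.lo a₁ a₂ a₃) (initialSlope a₁ a₂ a₃ β ω U e) (-initialValue a₃ β ω U e) x

/-- On every edge the initial data are combinations, with coefficients depending only on the type of
the edge, of the values at one or two neighbouring vertices. -/
theorem summable_initial_sq (a₁ a₂ a₃ β ω : ℝ) (g : TorusL2) :
    Summable fun e => (‖initialValue a₃ β ω (coeff g) e‖ +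
      ‖initialSlope a₁ a₂ a₃ β ω (coeff g) e‖) ^ 2 := by
  have h0 := summable_sq_coeff g
  have h1 : Summable fun p : ℤ × ℤ => ‖coeff g (p.1 + 1) p.2‖ ^ 2 := by
    simpa using summable_sq_coeff_shift g 1 0
  have h2 : Summable fun p : ℤ × ℤ => ‖coeff g p.1 (p.2 + 1)‖ ^ 2 := by
    simpa using summable_sq_coeff_shift g 0 1
  refine summable_add_sq (summable_edge h0 h0 h0 ?_) (summable_edge ?_ ?_ ?_ ?_)
  · refine (summable_norm_mul_add_mul_sq (Complex.exp (Complex.I * β) * (Real.cos (ω * (a₃ / 2)) +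
      (Complex.exp (-(Complex.I * β)) - Real.cos (ω * a₃)) / Real.sin (ω * a₃) *
        Real.sin (ω * (a₃ / 2)))) 0 h0 h0).congr fun p => ?_
    rw [initialValue]
    congr 2
    ring
  · refine (summable_norm_mul_add_mul_sq (1 / Real.sin (ω * a₁) : ℂ)
      (-Real.cos (ω * a₁) / Real.sin (ω * a₁)) h1 h0).congr fun p => ?_
    rw [initialSlope]
    congr 2
    ring
  · refine (summable_norm_mul_add_mul_sq (1 / Real.sin (ω * a₂) : ℂ)
      (-Real.cos (ω * a₂) / Real.sin (ω * a₂)) h2 h0).congr fun p => ?_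
    rw [initialSlope]
    congr 2
    ring
  · refine (summable_norm_mul_add_mul_sq ((Complex.exp (-(Complex.I * β)) - Real.cos (ω * a₃)) /
      Real.sin (ω * a₃)) 0 h0 h0).congr fun p => ?_
    rw [initialSlope]
    congr 2
    ring
  · refine (summable_norm_mul_add_mul_sq (Complex.exp (Complex.I * β) *
      (-Real.sin (ω * (a₃ / 2)) +
      (Complex.exp (-(Complex.I * β)) - Real.cos (ω * a₃)) / Real.sin (ω * a₃) *
        Real.cos (ω * (a₃ / 2)))) 0 h0 h0).congr fun p => ?_
    rw [initialSlope]
    congr 2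
    ring

theorem interpolation_vertex (a₁ a₂ a₃ β ω : ℝ) (U : ℤ → ℤ → ℂ) (k l : ℤ) :
    interpolation a₁ a₂ a₃ β ω U (.horiz₁ k l) (k * a₁) = U k l :=
  trigSolution_self _ _ _ _

theorem isGraphH2_interpolation {a₁ a₂ a₃ ω : ℝ} (ha₁ : 0 < a₁) (ha₂ : 0 < a₂) (ha₃ : 0 < a₃)
    (hs₁ : Real.sin (ω * a₁) ≠ 0) (hs₂ : Real.sin (ω * a₂) ≠ 0) (hs₃ : Real.sin (ω * a₃) ≠ 0)
    (β : ℝ) (g : TorusL2) :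
    IsGraphH2 a₁ a₂ a₃ (interpolation a₁ a₂ a₃ β ω (coeff g))
      (interpolationDeriv a₁ a₂ a₃ β ω (coeff g))
      (fun e x => -ω ^ 2 * interpolation a₁ a₂ a₃ β ω (coeff g) e x) := by
  have hsum := summable_initial_sq a₁ a₂ a₃ β ω g
  have hmem : MemLp (fun p : Edge × ℝ => interpolation a₁ a₂ a₃ β ω (coeff g) p.1 p.2) 2
      (graphMeasure a₁ a₂ a₃ 1) :=
    memLp_graph ha₁ ha₂ ha₃ 1 (fun e => continuous_trigSolution _ _ _ _)
      (fun e x _ => norm_trigSolution_le _ _ _ _ _) hsum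
  refine ⟨fun e => isSobolevH2_trigSolution ω _ _ _ _ _, fun k l => ⟨coeff g k l, ?_⟩, hmem,
    MemLp.const_mul (memLp_graph ha₁ ha₂ ha₃ 1 (fun e => continuous_trigSolution ω
      (e.lo a₁ a₂ a₃) (initialSlope a₁ a₂ a₃ β ω (coeff g) e) (-initialValue a₃ β ω (coeff g) e))
      (fun e x _ => (norm_trigSolution_le _ _ _ _ _).trans_eq (by rw [norm_neg, add_comm])) hsum) _,
    hmem.const_mul _⟩
  have hs₁' : (Real.sin (ω * a₁) : ℂ) ≠ 0 := by exact_mod_cast hs₁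
  have hs₂' : (Real.sin (ω * a₂) : ℂ) ≠ 0 := by exact_mod_cast hs₂
  have hs₃' : (Real.sin (ω * a₃) : ℂ) ≠ 0 := by exact_mod_cast hs₃
  refine ⟨trigSolution_self _ _ _ _, ?_, trigSolution_self _ _ _ _, ?_, trigSolution_self _ _ _ _, ?_⟩
  · rw [interpolation, trigSolution_eq (d := a₁) (by simp only [Edge.lo]; push_cast; ring),
      initialValue, initialSlope, sub_add_cancel, div_mul_cancel₀ _ hs₁']
    ring
  · rw [interpolation, trigSolution_eq (d := a₂) (by simp only [Edge.lo]; push_cast; ring),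
      initialValue, initialSlope, sub_add_cancel, div_mul_cancel₀ _ hs₂']
    ring
  · rw [interpolation, trigSolution_eq (d := a₃ / 2) (by simp only [Edge.lo]; ring),
      initialValue, initialSlope]
    have hsin : (Real.sin (ω * a₃) : ℂ) =
        2 * Real.sin (ω * (a₃ / 2)) * Real.cos (ω * (a₃ / 2)) := by
      rw [show ω * a₃ = 2 * (ω * (a₃ / 2)) by ring, Real.sin_two_mul]
      push_cast
      rfl
    have hcos : (Real.cos (ω * a₃) : ℂ) =
        (Real.cos (ω * (a₃ / 2)) : ℂ) ^ 2 - (Real.sin (ω * (a₃ / 2)) : ℂ) ^ 2 := by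
      rw [show ω * a₃ = 2 * (ω * (a₃ / 2)) by ring, Real.cos_two_mul']
      push_cast
      rfl
    have hqq : Complex.exp (-(Complex.I * β)) * Complex.exp (Complex.I * β) = 1 := by
      rw [← Complex.exp_add, neg_add_cancel, Complex.exp_zero]
    set q := Complex.exp (-(Complex.I * β))
    set q' := Complex.exp (Complex.I * β)
    set s := (Real.sin (ω * (a₃ / 2)) : ℂ)
    set c := (Real.cos (ω * (a₃ / 2)) : ℂ)
    -- At the upper end of the lower edge the value is `e^{iβ} (cos (ω a₃) + r sin (ω a₃)) U`, where
    -- `r` is the slope coefficient of the upper edge, chosen to make the bracket `e^{-iβ}`.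
    have hr : (q - Real.cos (ω * a₃)) / Real.sin (ω * a₃) * (2 * s * c) =
        q - (c ^ 2 - s ^ 2) := by
      rw [← hsin, div_mul_cancel₀ _ hs₃', hcos]
    linear_combination q' * coeff g k l * hr + coeff g k l * hqq

theorem isEdgeSolution_interpolation {a₁ a₂ a₃ ω : ℝ} (ha₁ : 0 < a₁) (ha₂ : 0 < a₂)
    (ha₃ : 0 < a₃) (hs₁ : Real.sin (ω * a₁) ≠ 0) (hs₂ : Real.sin (ω * a₂) ≠ 0)
    (hs₃ : Real.sin (ω * a₃) ≠ 0) (β : ℝ) (g : TorusL2) :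
    IsEdgeSolution a₁ a₂ a₃ β ω (interpolation a₁ a₂ a₃ β ω (coeff g))
      (interpolationDeriv a₁ a₂ a₃ β ω (coeff g))
      (fun e x => -ω ^ 2 * interpolation a₁ a₂ a₃ β ω (coeff g) e x) := by
  have hqq : Complex.exp (-(Complex.I * β)) * Complex.exp (Complex.I * β) = 1 := by
    rw [← Complex.exp_add, neg_add_cancel, Complex.exp_zero]
  refine ⟨isGraphH2_interpolation ha₁ ha₂ ha₃ hs₁ hs₂ hs₃ β g, fun k l => ?_, fun k l => ?_,
    fun e => .of_forall fun x => rfl⟩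
  · rw [interpolation, interpolation, trigSolution_eq (d := a₃ / 2) (by simp only [Edge.lo]; ring),
      trigSolution_eq (s := Edge.lo _ _ _ (.down k l)) (d := 0) (by simp only [Edge.lo]; ring)]
    simp only [initialValue, initialSlope, mul_zero, Real.cos_zero, Real.sin_zero,
      Complex.ofReal_one, Complex.ofReal_zero, mul_one, add_zero]
    rw [← mul_assoc, hqq, one_mul]
  · rw [interpolationDeriv, interpolationDeriv,
      trigSolution_eq (d := a₃ / 2) (by simp only [Edge.lo]; ring),
      trigSolution_eq (s := Edge.lo _ _ _ (.down k l)) (d := 0) (by simp only [Edge.lo]; ring)]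
    simp only [initialValue, initialSlope, mul_zero, Real.cos_zero, Real.sin_zero,
      Complex.ofReal_one, Complex.ofReal_zero, mul_one, add_zero]
    linear_combination -ω * (-coeff g k l * Real.sin (ω * (a₃ / 2)) +
      (Complex.exp (-(Complex.I * β)) - Real.cos (ω * a₃)) / Real.sin (ω * a₃) * coeff g k l *
        Real.cos (ω * (a₃ / 2))) * hqq

end Interpolation

/-! ### Functions supported on the horizontal edges of the first type -/

section Source

/-- The function equal to `G k l * p (x - k a₁)` on the edge `horiz₁ k l`, and to zero on the
other edges. -/
noncomputable def horizontalFun (a₁ : ℝ) (G : ℤ → ℤ → ℂ) (p : ℝ → ℝ) : Edge → ℝ → ℂ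
  | .horiz₁ k l => fun x => G k l * p (x - k * a₁)
  | _ => fun _ => 0

theorem continuous_horizontalFun (a₁ : ℝ) (G : ℤ → ℤ → ℂ) {p : ℝ → ℝ} (hp : Continuous p)
    (e : Edge) : Continuous (horizontalFun a₁ G p e) := by
  cases e <;> simp only [horizontalFun] <;> fun_prop

/-- A bound for `horizontalFun` on the edges. -/
noncomputable def horizontalBound (G : ℤ → ℤ → ℂ) (M : ℝ) : Edge → ℝ
  | .horiz₁ k l => ‖G k l‖ * M
  | _ => 0

theorem norm_horizontalFun_le {a₁ : ℝ} (a₂ a₃ : ℝ) (G : ℤ → ℤ → ℂ) {p : ℝ → ℝ} {M : ℝ}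
    (hM : ∀ x ∈ Icc 0 a₁, |p x| ≤ M) (e : Edge) {x : ℝ}
    (hx : x ∈ Icc (e.lo a₁ a₂ a₃) (e.hi a₁ a₂ a₃)) :
    ‖horizontalFun a₁ G p e x‖ ≤ horizontalBound G M e := by
  cases e with
  | horiz₁ k l =>
    simp only [Edge.lo, Edge.hi, mem_Icc] at hx
    simp only [horizontalFun, horizontalBound, norm_mul, Complex.norm_real]
    exact mul_le_mul_of_nonneg_left (hM _ ⟨by linarith, by linarith⟩) (norm_nonneg _)
  | _ => simp [horizontalFun, horizontalBound]

theorem hasSum_horizontalBound {G : ℤ → ℤ → ℂ} {S : ℝ}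
    (hG : HasSum (fun p : ℤ × ℤ => ‖G p.1 p.2‖ ^ 2) S) (M : ℝ) :
    HasSum (fun e => horizontalBound G M e ^ 2) (S * M ^ 2) := by
  have hi : Function.Injective fun p : ℤ × ℤ => Edge.horiz₁ p.1 p.2 := by
    rintro ⟨k, l⟩ ⟨k', l'⟩ h
    simpa using h
  rw [← hi.hasSum_iff]
  · simpa [Function.comp_def, horizontalBound, mul_pow] using hG.mul_right (M ^ 2)
  · rintro (⟨k, l⟩ | _ | _ | _) h
    · exact absurd ⟨(k, l), rfl⟩ h
    all_goals simp [horizontalBound]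

theorem exists_bound_Icc {p : ℝ → ℝ} (hp : Continuous p) (a : ℝ) :
    ∃ M, ∀ x ∈ Icc 0 a, |p x| ≤ M :=
  isCompact_Icc.exists_bound_of_continuousOn hp.continuousOn

theorem memLp_horizontalFun {a₁ a₂ a₃ : ℝ} (ha₁ : 0 < a₁) (ha₂ : 0 < a₂) (ha₃ : 0 < a₃) (μ : ℝ)
    {G : ℤ → ℤ → ℂ} (hG : Summable fun p : ℤ × ℤ => ‖G p.1 p.2‖ ^ 2) {p : ℝ → ℝ}
    (hp : Continuous p) :
    MemLp (fun q : Edge × ℝ => horizontalFun a₁ G p q.1 q.2) 2 (graphMeasure a₁ a₂ a₃ μ) := by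
  obtain ⟨M, hM⟩ := exists_bound_Icc hp a₁
  exact memLp_graph ha₁ ha₂ ha₃ μ (continuous_horizontalFun a₁ G hp)
    (fun e x hx => norm_horizontalFun_le a₂ a₃ G hM e hx) (hasSum_horizontalBound hG.hasSum M).summable

/-- The operator that maps `g` to the function on the graph with values `coeff g k l * r` on
`horiz₁ k l`. -/
noncomputable def sourceMap {a₁ a₂ a₃ : ℝ} (ha₁ : 0 < a₁) (ha₂ : 0 < a₂) (ha₃ : 0 < a₃) (μ : ℝ)
    {r : ℝ → ℝ} (hr : Continuous r) : TorusL2 →ₗ[ℂ] GraphL2 a₁ a₂ a₃ μ where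
  toFun g := (memLp_horizontalFun ha₁ ha₂ ha₃ μ (summable_sq_coeff g) hr).toLp
  map_add' g h := by
    rw [← MemLp.toLp_add]
    refine MemLp.toLp_congr _ _ (.of_forall ?_)
    rintro ⟨_ | _ | _ | _, x⟩ <;> simp [horizontalFun, coeff_add, add_mul]
  map_smul' c g := by
    rw [RingHom.id_apply, ← MemLp.toLp_const_smul]
    refine MemLp.toLp_congr _ _ (.of_forall ?_)
    rintro ⟨_ | _ | _ | _, x⟩ <;> simp [horizontalFun, coeff_smul, mul_assoc]

theorem coeFn_sourceMap {a₁ a₂ a₃ : ℝ} (ha₁ : 0 < a₁) (ha₂ : 0 < a₂) (ha₃ : 0 < a₃) (μ : ℝ)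
    {r : ℝ → ℝ} (hr : Continuous r) (g : TorusL2) :
    ∀ᵐ q ∂(graphMeasure a₁ a₂ a₃ μ),
      sourceMap ha₁ ha₂ ha₃ μ hr g q = horizontalFun a₁ (coeff g) r q.1 q.2 :=
  MemLp.coeFn_toLp (memLp_horizontalFun ha₁ ha₂ ha₃ μ (summable_sq_coeff g) hr)

/-- By Parseval the squared norm of the image is at most `D ‖g‖²`. Continuity is needed to pull the
closed range back to the torus. -/
theorem continuous_sourceMap {a₁ a₂ a₃ : ℝ} (ha₁ : 0 < a₁) (ha₂ : 0 < a₂) (ha₃ : 0 < a₃) (μ : ℝ)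
    {r : ℝ → ℝ} (hr : Continuous r) : Continuous (sourceMap ha₁ ha₂ ha₃ μ hr) := by
  obtain ⟨M, hM⟩ := exists_bound_Icc hr a₁
  set D : ℝ := max 1 μ * (a₁ + a₂ + a₃) * M ^ 2 with hD
  have hM1 : 0 ≤ max 1 μ := le_max_of_le_left zero_le_one
  have hD0 : 0 ≤ D := by positivity
  refine AddMonoidHomClass.continuous_of_bound (sourceMap ha₁ ha₂ ha₃ μ hr) (Real.sqrt D)
    fun g => ?_
  refine abs_le_of_sq_le_sq' ?_ (by positivity) |>.2
  have hS := hasSum_horizontalBound (hasSum_sq_coeff g) M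
  have h := lintegral_graph_sq_le ha₁ ha₂ ha₃ μ
    (fun e x hx => norm_horizontalFun_le a₂ a₃ (coeff g) hM e hx) hS.summable
  rw [← eLpNorm_two_sq _ fun q : Edge × ℝ => horizontalFun a₁ (coeff g) r q.1 q.2, hS.tsum_eq] at h
  have h2 : ‖sourceMap ha₁ ha₂ ha₃ μ hr g‖ = (eLpNorm (fun q : Edge × ℝ =>
      horizontalFun a₁ (coeff g) r q.1 q.2) 2 (graphMeasure a₁ a₂ a₃ μ)).toReal :=
    Lp.norm_toLp _ (memLp_horizontalFun ha₁ ha₂ ha₃ μ (summable_sq_coeff g) hr)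
  rw [h2, ← ENNReal.toReal_pow, mul_pow, Real.sq_sqrt hD0]
  refine (ENNReal.toReal_mono ENNReal.ofReal_ne_top h).trans_eq ?_
  rw [ENNReal.toReal_ofReal (by positivity), hD]
  ring

/-! ### A function with given derivative at a vertex -/

/-- A polynomial that vanishes at `0` with derivative `1`, and to second order at `a`. -/
noncomputable def bump (a x : ℝ) : ℝ := x - 2 * x ^ 2 / a + x ^ 3 / a ^ 2

/-- The derivative of `bump`. -/
noncomputable def bumpDeriv (a x : ℝ) : ℝ := 1 - 4 * x / a + 3 * x ^ 2 / a ^ 2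

/-- The second derivative of `bump`. -/
noncomputable def bumpDeriv2 (a x : ℝ) : ℝ := -4 / a + 6 * x / a ^ 2

theorem hasDerivAt_bump (a x : ℝ) : HasDerivAt (bump a) (bumpDeriv a x) x := by
  have h := ((hasDerivAt_id x).sub ((((hasDerivAt_id x).pow 2).const_mul 2).div_const a)).add
    (((hasDerivAt_id x).pow 3).div_const (a ^ 2))
  refine h.congr_deriv ?_
  simp [bumpDeriv]
  ring

theorem hasDerivAt_bumpDeriv (a x : ℝ) : HasDerivAt (bumpDeriv a) (bumpDeriv2 a x) x := by
  have h := (((hasDerivAt_const x (1 : ℝ)).sub (((hasDerivAt_id x).const_mul 4).div_const a))).add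
    ((((hasDerivAt_id x).pow 2).const_mul 3).div_const (a ^ 2))
  refine h.congr_deriv ?_
  simp [bumpDeriv2]
  ring

theorem continuous_bump (a : ℝ) : Continuous (bump a) := by
  unfold bump
  fun_prop

theorem continuous_bumpDeriv (a : ℝ) : Continuous (bumpDeriv a) := by
  unfold bumpDeriv
  fun_prop

theorem continuous_bumpDeriv2 (a : ℝ) : Continuous (bumpDeriv2 a) := by
  unfold bumpDeriv2
  fun_prop

theorem bump_zero (a : ℝ) : bump a 0 = 0 := by simp [bump]

theorem bumpDeriv_zero (a : ℝ) : bumpDeriv a 0 = 1 := by simp [bumpDeriv]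

theorem bump_self (a : ℝ) : bump a a = 0 := by
  unfold bump
  field_simp
  ring

theorem bumpDeriv_self {a : ℝ} (ha : a ≠ 0) : bumpDeriv a a = 0 := by
  unfold bumpDeriv
  field_simp
  ring

theorem horizontalFun_lo (a₁ : ℝ) (G : ℤ → ℤ → ℂ) (p : ℝ → ℝ) (k l : ℤ) :
    horizontalFun a₁ G p (.horiz₁ k l) (k * a₁) = G k l * p 0 := by
  simp [horizontalFun]

theorem horizontalFun_hi (a₁ : ℝ) (G : ℤ → ℤ → ℂ) (p : ℝ → ℝ) (k l : ℤ) :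
    horizontalFun a₁ G p (.horiz₁ (k - 1) l) (k * a₁) = G (k - 1) l * p a₁ := by
  have : (k : ℝ) * a₁ - (k - 1 : ℤ) * a₁ = a₁ := by push_cast; ring
  simp only [horizontalFun, this]

theorem hasDerivAt_horizontalFun (a₁ : ℝ) (G : ℤ → ℤ → ℂ) {p p' : ℝ → ℝ}
    (hp : ∀ x, HasDerivAt p (p' x) x) (e : Edge) (x : ℝ) :
    HasDerivAt (horizontalFun a₁ G p e) (horizontalFun a₁ G p' e x) x := by
  cases e with
  | horiz₁ k l => exact ((hp _).comp_sub_const x (k * a₁)).ofReal_comp.const_mul (G k l)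
  | _ => exact hasDerivAt_const x 0

theorem isGraphH2_bump {a₁ a₂ a₃ : ℝ} (ha₁ : 0 < a₁) (ha₂ : 0 < a₂) (ha₃ : 0 < a₃)
    {G : ℤ → ℤ → ℂ} (hG : Summable fun p : ℤ × ℤ => ‖G p.1 p.2‖ ^ 2) :
    IsGraphH2 a₁ a₂ a₃ (horizontalFun a₁ G (bump a₁)) (horizontalFun a₁ G (bumpDeriv a₁))
      (horizontalFun a₁ G (bumpDeriv2 a₁)) where
  edge e := isSobolevH2_of_hasDerivAt (hasDerivAt_horizontalFun a₁ G (hasDerivAt_bump a₁) e)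
    (hasDerivAt_horizontalFun a₁ G (hasDerivAt_bumpDeriv a₁) e)
    (continuous_horizontalFun a₁ G (continuous_bumpDeriv2 a₁) e)
  continuous_vertex k l := by
    refine ⟨0, ?_, ?_, rfl, rfl, rfl, rfl⟩
    · rw [horizontalFun_lo, bump_zero, Complex.ofReal_zero, mul_zero]
    · rw [horizontalFun_hi, bump_self a₁, Complex.ofReal_zero, mul_zero]
  memLp := memLp_horizontalFun ha₁ ha₂ ha₃ 1 hG (continuous_bump a₁)
  memLp_deriv := memLp_horizontalFun ha₁ ha₂ ha₃ 1 hG (continuous_bumpDeriv a₁)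
  memLp_deriv2 := memLp_horizontalFun ha₁ ha₂ ha₃ 1 hG (continuous_bumpDeriv2 a₁)

/-- The polynomial is `x (1 - x/a)²`: of its values and derivatives at the two ends, only the
derivative at the start is non-zero. So the Kirchhoff defect can be prescribed at each vertex
separately without disturbing the vertex values. -/
theorem kirchhoffSum_bump {a₁ : ℝ} (ha₁ : 0 < a₁) (a₂ μ : ℝ) (G : ℤ → ℤ → ℂ) (k l : ℤ) :
    kirchhoffSum a₁ a₂ μ (horizontalFun a₁ G (bumpDeriv a₁)) k l = G k l := by
  rw [kirchhoffSum, horizontalFun_lo, horizontalFun_hi, bumpDeriv_zero, bumpDeriv_self ha₁.ne']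
  simp [horizontalFun]

theorem kirchhoffSum_add (a₁ a₂ μ : ℝ) (u' v' : Edge → ℝ → ℂ) (k l : ℤ) :
    kirchhoffSum a₁ a₂ μ (u' + v') k l =
      kirchhoffSum a₁ a₂ μ u' k l + kirchhoffSum a₁ a₂ μ v' k l := by
  simp only [kirchhoffSum, Pi.add_apply]
  ring

theorem IsGraphH2.add {a₁ a₂ a₃ : ℝ} {u u' u'' v v' v'' : Edge → ℝ → ℂ}
    (hu : IsGraphH2 a₁ a₂ a₃ u u' u'') (hv : IsGraphH2 a₁ a₂ a₃ v v' v'') :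
    IsGraphH2 a₁ a₂ a₃ (u + v) (u' + v') (u'' + v'') where
  edge e := (hu.edge e).add (hv.edge e)
  continuous_vertex k l := by
    obtain ⟨c, h1, h2, h3, h4, h5, h6⟩ := hu.continuous_vertex k l
    obtain ⟨d, g1, g2, g3, g4, g5, g6⟩ := hv.continuous_vertex k l
    exact ⟨c + d, by simp [*]⟩
  memLp := hu.memLp.add hv.memLp
  memLp_deriv := hu.memLp_deriv.add hv.memLp_deriv
  memLp_deriv2 := hu.memLp_deriv2.add hv.memLp_deriv2

end Source

/-! ### Eigenvalues and Fredholm property of the limit operator -/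

section LimitOperator

theorem isEigenvalue_limitOperator_iff {a₁ a₂ a₃ β μ : ℝ} (hμ : 0 < μ) (z : ℂ) :
    IsEigenvalue (limitOperator a₁ a₂ a₃ β μ) z ↔
      ∃ p : GraphL2 a₁ a₂ a₃ μ, p ≠ 0 ∧ (p, z • p) ∈ limitOperatorGraph a₁ a₂ a₃ β μ := by
  rw [← limitOperator_graph hμ]
  constructor
  · rintro ⟨u, hu, h⟩
    exact ⟨u, hu, by rw [← h]; exact LinearPMap.mem_graph _ u⟩
  · rintro ⟨p, hp, h⟩
    obtain ⟨u, hu, h⟩ := (LinearPMap.mem_graph_iff _).1 h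
    exact ⟨u, by rwa [hu], by rw [h, hu]⟩

theorem mem_range_shiftedMap_iff {a₁ a₂ a₃ β μ : ℝ} (hμ : 0 < μ) (z : ℂ) (r : GraphL2 a₁ a₂ a₃ μ) :
    r ∈ LinearMap.range (shiftedMap (limitOperator a₁ a₂ a₃ β μ) z) ↔
      ∃ p : GraphL2 a₁ a₂ a₃ μ, (p, r + z • p) ∈ limitOperatorGraph a₁ a₂ a₃ β μ := by
  rw [← limitOperator_graph hμ]
  constructor
  · rintro ⟨u, rfl⟩
    refine ⟨u, ?_⟩
    convert LinearPMap.mem_graph (limitOperator a₁ a₂ a₃ β μ) u using 2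
    simp [shiftedMap]
  · rintro ⟨p, h⟩
    obtain ⟨u, hu, h⟩ := (LinearPMap.mem_graph_iff _).1 h
    refine ⟨u, ?_⟩
    have h' : (limitOperator a₁ a₂ a₃ β μ).toFun u = r + z • p := h
    simp only at hu
    simp [shiftedMap, h', hu]

variable {a₁ a₂ a₃ β μ ω : ℝ}

/-- An eigenfunction yields `g` through its vertex values, and `g` yields an eigenfunction by
interpolation. The Kirchhoff conditions are `T g = 0` in Fourier coefficients, and non-vanishing is
preserved because vertex values determine the solution. -/
theorem isEigenvalue_iff_vertexOp (ha₁ : 0 < a₁) (ha₂ : 0 < a₂) (ha₃ : 0 < a₃) (hμ : 0 < μ)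
    (hω : ω ≠ 0) (hs₁ : Real.sin (ω * a₁) ≠ 0) (hs₂ : Real.sin (ω * a₂) ≠ 0)
    (hs₃ : Real.sin (ω * a₃) ≠ 0) :
    IsEigenvalue (limitOperator a₁ a₂ a₃ β μ) ((ω ^ 2 : ℝ) : ℂ) ↔
      ∃ g, g ≠ 0 ∧ vertexOp a₁ a₂ a₃ β μ ω g = 0 := by
  rw [isEigenvalue_limitOperator_iff hμ]
  constructor
  · rintro ⟨p, hp, u, u', u'', hu, h1, h2⟩
    have hode : ∀ᵐ x ∂(graphMeasure a₁ a₂ a₃ μ), u'' x.1 x.2 = -(ω : ℂ) ^ 2 * u x.1 x.2 := by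
      filter_upwards [h1, h2, Lp.coeFn_smul ((ω ^ 2 : ℝ) : ℂ) p] with x e1 e2 e3
      rw [e3, Pi.smul_apply, e1, smul_eq_mul] at e2
      push_cast at e2
      linear_combination e2
    have hsol : IsEdgeSolution a₁ a₂ a₃ β ω u u' u'' :=
      ⟨hu.h2, hu.quasiperiodic, hu.quasiperiodic_deriv, (ae_graphMeasure_iff hμ).1 hode⟩
    obtain ⟨g, hg⟩ := hsol.exists_coeff_eq_vertex ha₁ ha₂ ha₃ hω
    refine ⟨g, ?_, ?_⟩
    · rintro rfl
      refine hp ((Lp.eq_zero_iff_ae_eq_zero).2 ?_)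
      have h0 : ∀ᵐ x ∂(graphMeasure a₁ a₂ a₃ μ), u x.1 x.2 = 0 :=
        (ae_graphMeasure_iff hμ).2 fun e =>
          (ae_restrict_iff' measurableSet_Icc).2 (.of_forall fun x hx =>
            hsol.eq_zero_of_vertex ha₁ ha₂ ha₃ hω hs₁ hs₂ hs₃
              (fun k l => by rw [← hg, coeff_zero]) e hx)
      filter_upwards [h1, h0] with x e1 e2
      exact e1.trans e2
    · refine coeff_ext fun k l => ?_
      rw [← hsol.kirchhoffSum_eq ha₁ ha₂ ha₃ hs₁ hs₂ hs₃ hg, coeff_zero]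
      exact hu.kirchhoff k l
  · rintro ⟨g, hg, hT⟩
    have hsol := isEdgeSolution_interpolation ha₁ ha₂ ha₃ hs₁ hs₂ hs₃ β g
    have hmem := hsol.h2.memLp.graph_of_one μ
    refine ⟨hmem.toLp, fun h0 => hg (coeff_ext fun k l => ?_), _, _, _,
      ⟨hsol.h2, hsol.quasiperiodic, hsol.quasiperiodic_deriv, fun k l => ?_⟩, hmem.coeFn_toLp, ?_⟩
    · have h1 : ∀ᵐ x ∂(graphMeasure a₁ a₂ a₃ μ),
          interpolation a₁ a₂ a₃ β ω (coeff g) x.1 x.2 = 0 := by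
        filter_upwards [hmem.coeFn_toLp, (Lp.eq_zero_iff_ae_eq_zero).1 h0] with x e1 e2
        rw [← e1, e2]
        rfl
      -- An almost everywhere zero interpolation is zero at the vertices by continuity on the edges.
      have h2 := (ae_graphMeasure_iff hμ).1 h1 (.horiz₁ k l)
      have hlt := Edge.lo_lt_hi ha₁ ha₂ ha₃ (.horiz₁ k l)
      have h3 := Measure.eqOn_Icc_of_ae_eq volume hlt.ne (g := fun _ => (0 : ℂ)) h2
        (hsol.h2.edge _).continuousOn continuousOn_const (left_mem_Icc.2 hlt.le)
      rw [coeff_zero, ← interpolation_vertex a₁ a₂ a₃ β ω (coeff g) k l]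
      exact h3
    · refine (hsol.kirchhoffSum_eq (μ := μ) ha₁ ha₂ ha₃ hs₁ hs₂ hs₃
        (fun k l => (interpolation_vertex a₁ a₂ a₃ β ω (coeff g) k l).symm) k l).trans ?_
      rw [hT, coeff_zero]
    · filter_upwards [hmem.coeFn_toLp, Lp.coeFn_smul ((ω ^ 2 : ℝ) : ℂ) hmem.toLp] with x e1 e2
      rw [e2, Pi.smul_apply, e1, smul_eq_mul]
      push_cast
      ring

/-- The source term that corresponds to a defect in the Kirchhoff conditions. -/
noncomputable def sourceProfile (a₁ ω x : ℝ) : ℝ := bumpDeriv2 a₁ x + ω ^ 2 * bump a₁ x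

theorem continuous_sourceProfile (a₁ ω : ℝ) : Continuous (sourceProfile a₁ ω) :=
  (continuous_bumpDeriv2 a₁).add (continuous_const.mul (continuous_bump a₁))

theorem horizontalFun_sourceProfile (a₁ ω : ℝ) (G : ℤ → ℤ → ℂ) (e : Edge) (x : ℝ) :
    horizontalFun a₁ G (sourceProfile a₁ ω) e x = horizontalFun a₁ G (bumpDeriv2 a₁) e x +
      ω ^ 2 * horizontalFun a₁ G (bump a₁) e x := by
  cases e
  · simp only [horizontalFun, sourceProfile]
    push_cast
    ring
  all_goals simp [horizontalFun]

theorem horizontalFun_neg (a₁ : ℝ) (G : ℤ → ℤ → ℂ) (p : ℝ → ℝ) (e : Edge) (x : ℝ) :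
    horizontalFun a₁ (-G) p e x = -horizontalFun a₁ G p e x := by
  cases e <;> simp [horizontalFun]

/-- Let `w` be the bump function with coefficients of `y`; the source is `w'' + ω² w`. If `-u'' - ω²
u` equals the source, then `u + w` solves the homogeneous equation on the edges and has Kirchhoff
defect `y`, while this defect is also `T` applied to its vertex values. Conversely, `w` is
subtracted from the interpolation of a preimage of `y`. -/
theorem sourceMap_mem_range_iff (ha₁ : 0 < a₁) (ha₂ : 0 < a₂) (ha₃ : 0 < a₃) (hμ : 0 < μ)
    (hω : ω ≠ 0) (hs₁ : Real.sin (ω * a₁) ≠ 0) (hs₂ : Real.sin (ω * a₂) ≠ 0)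
    (hs₃ : Real.sin (ω * a₃) ≠ 0) (y : TorusL2) :
    sourceMap ha₁ ha₂ ha₃ μ (continuous_sourceProfile a₁ ω) y ∈
      LinearMap.range (shiftedMap (limitOperator a₁ a₂ a₃ β μ) ((ω ^ 2 : ℝ) : ℂ)) ↔
      ∃ x, vertexOp a₁ a₂ a₃ β μ ω x = y := by
  rw [mem_range_shiftedMap_iff hμ]
  have hB := coeFn_sourceMap ha₁ ha₂ ha₃ μ (continuous_sourceProfile a₁ ω) y
  constructor
  · rintro ⟨p, u, u', u'', hu, h1, h2⟩
    have hode : ∀ᵐ x ∂(graphMeasure a₁ a₂ a₃ μ),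
        (u'' + horizontalFun a₁ (coeff y) (bumpDeriv2 a₁)) x.1 x.2 =
          -(ω : ℂ) ^ 2 * (u + horizontalFun a₁ (coeff y) (bump a₁)) x.1 x.2 := by
      filter_upwards [h1, h2, hB, Lp.coeFn_smul ((ω ^ 2 : ℝ) : ℂ) p,
        Lp.coeFn_add (sourceMap ha₁ ha₂ ha₃ μ (continuous_sourceProfile a₁ ω) y)
          (((ω ^ 2 : ℝ) : ℂ) • p)] with x e1 e2 e3 e4 e5
      rw [e5, Pi.add_apply, e4, Pi.smul_apply, e1, e3, smul_eq_mul,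
        horizontalFun_sourceProfile] at e2
      push_cast at e2
      simp only [Pi.add_apply]
      linear_combination e2
    have hsol : IsEdgeSolution a₁ a₂ a₃ β ω (u + horizontalFun a₁ (coeff y) (bump a₁))
        (u' + horizontalFun a₁ (coeff y) (bumpDeriv a₁))
        (u'' + horizontalFun a₁ (coeff y) (bumpDeriv2 a₁)) := by
      refine ⟨hu.h2.add (isGraphH2_bump ha₁ ha₂ ha₃ (summable_sq_coeff y)), fun k l => ?_,
        fun k l => ?_, (ae_graphMeasure_iff hμ).1 hode⟩
      · simpa [horizontalFun] using hu.quasiperiodic k l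
      · simpa [horizontalFun] using hu.quasiperiodic_deriv k l
    obtain ⟨g, hg⟩ := hsol.exists_coeff_eq_vertex ha₁ ha₂ ha₃ hω
    refine ⟨g, coeff_ext fun k l => ?_⟩
    rw [← hsol.kirchhoffSum_eq ha₁ ha₂ ha₃ hs₁ hs₂ hs₃ hg, kirchhoffSum_add,
      kirchhoffSum_bump ha₁]
    have : kirchhoffSum a₁ a₂ μ u' k l = 0 := hu.kirchhoff k l
    rw [this, zero_add]
  · rintro ⟨g, rfl⟩
    set y := vertexOp a₁ a₂ a₃ β μ ω g
    have hsol := isEdgeSolution_interpolation ha₁ ha₂ ha₃ hs₁ hs₂ hs₃ β g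
    have hG : Summable fun p : ℤ × ℤ => ‖(-coeff y) p.1 p.2‖ ^ 2 := by
      simpa using summable_sq_coeff y
    have h2 := hsol.h2.add (isGraphH2_bump ha₁ ha₂ ha₃ hG)
    have hmem := h2.memLp.graph_of_one μ
    refine ⟨hmem.toLp, _, _, _, ⟨h2, fun k l => ?_, fun k l => ?_, fun k l => ?_⟩,
      hmem.coeFn_toLp, ?_⟩
    · simpa [horizontalFun] using hsol.quasiperiodic k l
    · simpa [horizontalFun] using hsol.quasiperiodic_deriv k l
    · have h3 := hsol.kirchhoffSum_eq (μ := μ) ha₁ ha₂ ha₃ hs₁ hs₂ hs₃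
        (fun k l => (interpolation_vertex a₁ a₂ a₃ β ω (coeff g) k l).symm) k l
      have h4 := kirchhoffSum_add a₁ a₂ μ (interpolationDeriv a₁ a₂ a₃ β ω (coeff g))
        (horizontalFun a₁ (-coeff y) (bumpDeriv a₁)) k l
      rw [h3, kirchhoffSum_bump ha₁] at h4
      exact h4.trans (add_neg_cancel _)
    · filter_upwards [hmem.coeFn_toLp, hB, Lp.coeFn_smul ((ω ^ 2 : ℝ) : ℂ) hmem.toLp,
        Lp.coeFn_add (sourceMap ha₁ ha₂ ha₃ μ (continuous_sourceProfile a₁ ω) y)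
          (((ω ^ 2 : ℝ) : ℂ) • hmem.toLp)] with x e1 e3 e4 e5
      rw [e5, Pi.add_apply, e4, Pi.smul_apply, e1, e3, smul_eq_mul, horizontalFun_sourceProfile]
      simp only [Pi.add_apply, horizontalFun_neg]
      push_cast
      ring

/-- If `A - ω²` is Fredholm, then the symbol of the vertex equation has no zero. -/
theorem vertexSymbol_ne_zero (ha₁ : 0 < a₁) (ha₂ : 0 < a₂) (ha₃ : 0 < a₃) (hμ : 0 < μ)
    (hω : ω ≠ 0) (hs₁ : Real.sin (ω * a₁) ≠ 0) (hs₂ : Real.sin (ω * a₂) ≠ 0)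
    (hs₃ : Real.sin (ω * a₃) ≠ 0)
    (hF : IsFredholmAt (limitOperator a₁ a₂ a₃ β μ) ((ω ^ 2 : ℝ) : ℂ)) (x : Torus) :
    vertexSymbol a₁ a₂ a₃ β ω x ≠ 0 := by
  obtain ⟨-, hcl, hfin⟩ := hF
  have hiff := sourceMap_mem_range_iff (β := β) ha₁ ha₂ ha₃ hμ hω hs₁ hs₂ hs₃
  set R := LinearMap.range (shiftedMap (limitOperator a₁ a₂ a₃ β μ) ((ω ^ 2 : ℝ) : ℂ))
  set B := sourceMap ha₁ ha₂ ha₃ μ (continuous_sourceProfile a₁ ω)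
  have hrange : IsClosed (range (vertexOp a₁ a₂ a₃ β μ ω)) := by
    -- The range of `T` is the preimage under `B` of the range of `A - ω²`.
    have : range (vertexOp a₁ a₂ a₃ β μ ω) = B ⁻¹' (R : Set (GraphL2 a₁ a₂ a₃ μ)) :=
      ext fun y => (hiff y).symm
    rw [this]
    exact hcl.preimage (continuous_sourceMap ha₁ ha₂ ha₃ μ (continuous_sourceProfile a₁ ω))
  have hker : FiniteDimensional ℂ (LinearMap.ker (vertexOp a₁ a₂ a₃ β μ ω).toLinearMap) := by
    -- If `T g = 0` and `B g` lies in the range of `A - ω²`, then `g = T y` for some `y`, and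
    -- symmetry gives `⟨g, g⟩ = ⟨T g, y⟩ = 0`. So `B` embeds the kernel into the cokernel.
    refine Module.Finite.of_injective ((R.mkQ ∘ₗ B).domRestrict
      (LinearMap.ker (vertexOp a₁ a₂ a₃ β μ ω).toLinearMap)) ?_
    rw [injective_iff_map_eq_zero]
    rintro ⟨g, hg⟩ h
    have h1 : B g ∈ R := by simpa using h
    obtain ⟨y, hy⟩ := (hiff g).1 h1
    have hg' : vertexOp a₁ a₂ a₃ β μ ω g = 0 := hg
    have h2 : inner ℂ (vertexOp a₁ a₂ a₃ β μ ω g) y = inner ℂ g (vertexOp a₁ a₂ a₃ β μ ω y) :=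
      inner_perturbedMulOp (star_vertexSymbol a₁ a₂ a₃ β ω) (Complex.conj_ofReal _) g y
    rw [hg', hy, inner_zero_left] at h2
    exact Subtype.ext (inner_self_eq_zero.1 h2.symm)
  exact ne_zero_of_isClosed_range hrange hker x

theorem sin_mul_ne_zero {a ω : ℝ} (ha : 0 < a) (h : ∀ n : ℤ, ω ≠ Real.pi * n / a) :
    Real.sin (ω * a) ≠ 0 := by
  intro h0
  obtain ⟨n, hn⟩ := Real.sin_eq_zero_iff.1 h0
  refine h n ?_
  rw [eq_div_iff ha.ne', ← hn, mul_comm]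

end LimitOperator

theorem lemma3 (a₁ a₂ a₃ β μ ω : ℝ) (ha₁ : 0 < a₁) (ha₂ : 0 < a₂) (ha₃ : 0 < a₃) (hμ : 0 < μ)
    (hω₁ : ∀ n : ℤ, ω ≠ Real.pi * n / a₁)
    (hω₂ : ∀ n : ℤ, ω ≠ Real.pi * n / a₂)
    (hω₃ : ∀ n : ℤ, ω ≠ Real.pi * n / a₃)
    (hess : ((ω ^ 2 : ℝ) : ℂ) ∉ essentialSpectrum (limitOperator a₁ a₂ a₃ β μ)) :
    -- the criterion is well posed: `F_β(ω)` is the inverse of a genuine, non-zero average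
    ((∀ ξ η : ℝ, phi a₃ β ω - symbolF a₁ a₂ ξ η ω ≠ 0) ∧
      IntegrableOn (fun p : ℝ × ℝ => phi a₃ β ω / (phi a₃ β ω - symbolF a₁ a₂ p.1 p.2 ω))
        (Ioo 0 (2 * Real.pi) ×ˢ Ioo 0 (2 * Real.pi)) ∧
      torusAverage a₁ a₂ a₃ β ω ≠ 0) ∧
    -- the criterion
    (IsEigenvalue (limitOperator a₁ a₂ a₃ β μ) ((ω ^ 2 : ℝ) : ℂ) ↔
      μ = 1 - bigF a₁ a₂ a₃ β ω) := by
  have hω : ω ≠ 0 := by simpa using hω₁ 0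
  have hs₁ := sin_mul_ne_zero ha₁ hω₁
  have hs₂ := sin_mul_ne_zero ha₂ hω₂
  have hs₃ := sin_mul_ne_zero ha₃ hω₃
  have hne : ∀ ξ η : ℝ, phi a₃ β ω - symbolF a₁ a₂ ξ η ω ≠ 0 :=
    (vertexSymbol_ne_zero_iff hω).1
      (vertexSymbol_ne_zero ha₁ ha₂ ha₃ hμ hω hs₁ hs₂ hs₃ (not_not.1 hess))
  exact ⟨⟨hne, integrableOn_criterion hne, (torusAverage_pos hne).ne'⟩,
    (isEigenvalue_iff_vertexOp ha₁ ha₂ ha₃ hμ hω hs₁ hs₂ hs₃).trans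
      (exists_vertexOp_eq_zero_iff hω hne)⟩
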